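/- **Setting.** There are $k=k_B+k_R$ input symbols, divided into a base layer of $k_B=\alpha k\ge 1$ symbols and a refinement layer of $k_R=(1-\alpha)k$ symbols. Let $\pi$ be any probability distribution on the degrees $\{1,\dots,k\}$ and let $\beta>0$. The encoder with parameter $\beta$ samples a degree $i$ from $\pi$ (the *original degree*) and then selects $i$ distinct input symbols (the *neighbours*) one after another, each time with probability proportional to weight among the symbols not yet selected, where base layer symbols have weight $\beta$ and refinement layer symbols have weight $1$. For parameter $0$ only refinement layer symbols are selectable (all $k_R$ of them are taken if $i\ge k_R$). Output symbols are generated independently. The receiver performs belief propagation decoding. An incoming output symbol is stripped of the already processed input symbols; it is discarded (redundant) if its reduced degree is $0$, its neighbour is put into the ripple if the reduced degree is $1$, and it is put into the cloud otherwise. In each decoding step a uniformly random symbol of the ripple is processed, i.e. removed from the ripple and from all cloud symbols; cloud symbols thereby reduced to degree one leave the cloud and release their neighbour into the ripple. Decoding stops when the ripple is empty. A decoder state $\boldsymbol d=[\boldsymbol\ell\ \boldsymbol r\ \boldsymbol c]$ consists of the numbers $\boldsymbol\ell=(\ell_B,\ell_R)$ of unprocessed symbols and $\boldsymbol r=(r_B,r_R)$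 of ripple symbols in the two layers, and the numbers $c_i$ of cloud symbols of original degree $i$. It is terminal, written $\boldsymbol d^T$, if $\boldsymbol r=\boldsymbol 0$. **Transmission with feedback.** Decoding is attempted after each received symbol. Phase 1 lasts as long as $\ell_B\neq 0$, and the encoder then uses the parameter $\beta$. As soon as the base layer is decoded, a perfect and immediate feedback message starts phase 2, in which the encoder uses the parameter $0$. Transmission ends when all input symbols are decoded. For an integer $\Delta_{max}\ge 0$ let $\mathbb E[\Delta^1_{\boldsymbol d}(\Delta_{max})]$, resp. $\mathbb E[\Delta^2_{\boldsymbol d}(\Delta_{max})]$, be the expected number of symbols received in phase 1, resp. phase 2, because decoding of the first $\Delta$ received symbols, for some $1\le\Delta\le\Delta_{max}$, stopped in the state $\boldsymbol d$ (such a symbol is the $(\Delta+1)$-th one). Let $\mathbb E[k\epsilon_0^F(\Delta_{max})]$ be the expected number of symbols of reduced degree zero on arrival among the at most $\Delta_{max}+1$ symbols received in this way, the first symbol included. **Reduced degree distribution.** Let $\Phi_\beta(j,i)$ be Wallenius' noncentral hypergeometric distribution, i.e. the probability that $j$ of $i$ objects are of the first kind if they are drawn one by one, without replacement, with probability proportional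 to weight, from $k_B$ objects of weight $\beta$ and $k_R$ objects of weight $1$ (draws that are impossible, because no weight is left, have probability zero). For $0\le i'_B\le\ell_B\le k_B$ and $0\le i'_R\le\ell_R\le k_R$, with $i'=i'_B+i'_R$, put $$\pi'_\beta(\boldsymbol i',\boldsymbol\ell)=\sum_{i=i'}^{i'+k-\ell_B-\ell_R}\pi(i)\sum_{\substack{j_B+j_R=i\\ j_B\ge i'_B,\ j_R\ge i'_R}}\Phi_\beta(j_B,i)\,\frac{\binom{\ell_B}{i'_B}\binom{k_B-\ell_B}{j_B-i'_B}}{\binom{k_B}{j_B}}\,\frac{\binom{\ell_R}{i'_R}\binom{k_R-\ell_R}{j_R-i'_R}}{\binom{k_R}{j_R}}$$ (terms with a vanishing denominator being zero), and $\pi'_\beta(\boldsymbol i',\boldsymbol\ell)=0$ elsewhere. **Terminal state distributions.** Let $f_{\boldsymbol D^T}(\boldsymbol d\mid\Delta^1)$ be the probability that decoding of a batch of $\Delta^1$ symbols encoded with parameter $\beta$ stops in the state $\boldsymbol d$. Let $f_{\boldsymbol D^T}(\boldsymbol d\mid\Delta^1,\Delta^2)$ be the probability of the following joint event: decoding of the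 first $\Delta^1-1$ symbols (parameter $\beta$) stops with $\ell_B\ne 0$; upon reception of the $\Delta^1$-th symbol (parameter $\beta$) decoding continues and stops with $\ell_B=0$ (the feedback state); and after $\Delta^2-\Delta^1$ further symbols, encoded with parameter $0$, have been collected in this state, decoding stops in the state $\boldsymbol d$. **Theorem (redundancy in a two-layer URT-LT code with feedback).** For every $\Delta_{max}\ge 0$, $$\mathbb E[k\epsilon_0^F(\Delta_{max})]=\sum_{\boldsymbol d^T:\ \ell^T_B\ne 0}\mathbb E[\Delta^1_{\boldsymbol d^T}(\Delta_{max})]\,\pi'_\beta(\boldsymbol 0,\boldsymbol\ell^T)+\sum_{\boldsymbol d^T:\ \ell^T_R\ne 0}\mathbb E[\Delta^2_{\boldsymbol d^T}(\Delta_{max})]\,\pi'_0(\boldsymbol 0,\boldsymbol\ell^T),$$ where both series converge, $$\mathbb E[\Delta^1_{\boldsymbol d^T}(\Delta_{max})]=\sum_{\Delta^1=1}^{\Delta_{max}}f_{\boldsymbol D^T}(\boldsymbol d^T\mid\Delta^1)\quad\text{for all terminal } \boldsymbol d^T \text{ with } \ell^T_B\neq 0,$$ $$\mathbb E[\Delta^2_{\boldsymbol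 d^T}(\Delta_{max})]=\sum_{\Delta^1=1}^{\Delta_{max}}\ \sum_{\Delta^2=\Delta^1}^{\Delta_{max}}f_{\boldsymbol D^T}(\boldsymbol d^T\mid\Delta^1,\Delta^2)\quad\text{for all terminal } \boldsymbol d^T \text{ with } \ell^T_R\neq 0.$$ -/

import Mathlib

open scoped NNReal ENNReal

noncomputable section

namespace URTLT

/-! ### Encoder -/

/-- The `k = kB + kR` input symbols: `Sum.inl` is the base layer (`α k = kB` symbols),
`Sum.inr` is the refinement layer (`(1 - α) k = kR` symbols). -/
abbrev InputSymbol (kB kR : ℕ) : Type := Fin kB ⊕ Fin kR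

/-- An output (encoded) symbol: its original degree (the degree sampled by the encoder)
together with the set of its neighbours. -/
abbrev OutputSymbol (kB kR : ℕ) : Type := ℕ × Finset (InputSymbol kB kR)

/-- Selection weight of an input symbol: `β` in the base layer, `1` in the refinement layer.
For `β = 0` the base layer is excluded from the selection. -/
def weight {kB kR : ℕ} (β : ℝ≥0) : InputSymbol kB kR → ℝ≥0 :=
  Sum.elim (fun _ => β) (fun _ => 1)

/-- Weights of the input symbols that have not been selected yet. -/
def remainingWeight {kB kR : ℕ} (β : ℝ≥0) (S : Finset (InputSymbol kB kR))
    (v : InputSymbol kB kR) : ℝ≥0∞ :=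
  if v ∈ S then 0 else (weight β v : ℝ≥0∞)

theorem tsum_remainingWeight_ne_top {kB kR : ℕ} (β : ℝ≥0)
    (S : Finset (InputSymbol kB kR)) : ∑' v, remainingWeight β S v ≠ ∞ := by
  rw [tsum_fintype]
  refine ENNReal.sum_ne_top.2 fun v _ => ?_
  unfold remainingWeight
  split_ifs <;> simp

open Classical in
/-- Select one further input symbol, different from those in `S`, with probability proportional
to its weight. If no selectable symbol of positive weight is left, nothing is added. -/
def selectOne {kB kR : ℕ} (β : ℝ≥0) (S : Finset (InputSymbol kB kR)) :
    PMF (Finset (InputSymbol kB kR)) :=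
  if h : ∑' v, remainingWeight β S v = 0 then PMF.pure S
  else (PMF.normalize (remainingWeight β S) h (tsum_remainingWeight_ne_top β S)).map
    fun v => insert v S

/-- The set of neighbours after `i` successive selections. -/
def selectNeighbours {kB kR : ℕ} (β : ℝ≥0) : ℕ → PMF (Finset (InputSymbol kB kR))
  | 0 => PMF.pure ∅
  | i + 1 => (selectNeighbours β i).bind (selectOne β)

/-- The encoder: sample a degree `i` from `π`, then select `i` neighbours. -/
def encode (kB kR : ℕ) (π : PMF ℕ) (β : ℝ≥0) : PMF (OutputSymbol kB kR) :=
  π.bind fun i => (selectNeighbours β i).map fun S => (i, S)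

/-- A batch of `n` independent output symbols. -/
def encodeBatch (kB kR : ℕ) (π : PMF ℕ) (β : ℝ≥0) : ℕ → PMF (Multiset (OutputSymbol kB kR))
  | 0 => PMF.pure 0
  | n + 1 => (encodeBatch kB kR π β n).bind fun m =>
      (encode kB kR π β).map fun c => c ::ₘ m

/-! ### Belief propagation decoder -/

/-- Full content of the receiver: the unprocessed input symbols, the ripple, and the cloud
(buffered output symbols with original degree and the set of remaining neighbours). -/
structure Receiver (kB kR : ℕ) where
  unprocessed : Finset (InputSymbol kB kR)
  ripple : Finset (InputSymbol kB kR)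
  cloud : Multiset (OutputSymbol kB kR)

/-- The receiver before the first reception. -/
def start (kB kR : ℕ) : Receiver kB kR := ⟨Finset.univ, ∅, 0⟩

open Classical in
/-- The input symbols recovered from output symbols of (reduced) degree one. -/
def released {kB kR : ℕ} (m : Multiset (OutputSymbol kB kR)) : Finset (InputSymbol kB kR) :=
  Finset.univ.filter fun w => ∃ c ∈ m, c.2 = {w}

/-- Reception of new output symbols: they are stripped of the processed input symbols; reduced
degree zero is discarded, reduced degree one goes to the ripple, the rest goes to the cloud. -/
def receive {kB kR : ℕ} (s : Receiver kB kR) (new : Multiset (OutputSymbol kB kR)) :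
    Receiver kB kR :=
  let reduced := new.map fun c => (c.1, c.2 ∩ s.unprocessed)
  { unprocessed := s.unprocessed
    ripple := s.ripple ∪ released reduced
    cloud := s.cloud + reduced.filter fun c => 2 ≤ c.2.card }

/-- Processing of the input symbol `v`: it is removed from all output symbols of the cloud, and
the output symbols that are now of degree one leave the cloud and release into the ripple. -/
def process {kB kR : ℕ} (s : Receiver kB kR) (v : InputSymbol kB kR) : Receiver kB kR :=
  let reduced := s.cloud.map fun c => (c.1, c.2.erase v)
  { unprocessed := s.unprocessed.erase v
    ripple := s.ripple.erase v ∪ released reduced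
    cloud := reduced.filter fun c => 2 ≤ c.2.card }

open Classical in
/-- One decoding step: process a uniformly random symbol of the ripple. If the ripple is empty,
the decoder has stopped. -/
def decodingStep {kB kR : ℕ} (s : Receiver kB kR) : PMF (Receiver kB kR) :=
  if h : s.ripple.Nonempty then (PMF.uniformOfFinset s.ripple h).map (process s)
  else PMF.pure s

/-- `n` decoding steps. -/
def decodingSteps {kB kR : ℕ} (s : Receiver kB kR) : ℕ → PMF (Receiver kB kR)
  | 0 => PMF.pure s
  | n + 1 => (decodingSteps s n).bind decodingStep

/-- A decoding attempt, until the ripple is empty. Every step processes one of the `kB + kR` input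
symbols, hence `kB + kR` steps suffice. -/
def decode {kB kR : ℕ} (s : Receiver kB kR) : PMF (Receiver kB kR) :=
  decodingSteps s (kB + kR)

/-! ### Decoder states -/

/-- A decoder state `d = [ℓ r c]`: numbers of unprocessed symbols of the two layers, numbers of
ripple symbols of the two layers, number `c i` of cloud symbols of original degree `i`. -/
@[ext]
structure DecoderState where
  lB : ℕ
  lR : ℕ
  rB : ℕ
  rR : ℕ
  c : ℕ → ℕ

/-- Terminal states are those with an empty ripple. -/
def DecoderState.IsTerminal (d : DecoderState) : Prop := d.rB = 0 ∧ d.rR = 0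

/-- The decoder state of a receiver. -/
def Receiver.state {kB kR : ℕ} (s : Receiver kB kR) : DecoderState where
  lB := (s.unprocessed.filter fun v => v.isLeft = true).card
  lR := (s.unprocessed.filter fun v => v.isRight = true).card
  rB := (s.ripple.filter fun v => v.isLeft = true).card
  rR := (s.ripple.filter fun v => v.isRight = true).card
  c i := (s.cloud.filter fun c => c.1 = i).card

/-! ### Reduced degree distribution -/

/-- Wallenius' noncentral hypergeometric distribution (two colours, weights `β` and `1`):
`wallenius kB kR β n j` is the probability that `j` of the first `n` objects are of the first
colour, when objects are drawn one by one without replacement from `kB` objects of weight `β` and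
`kR` objects of weight `1`, each time with probability proportional to weight. -/
def wallenius (kB kR : ℕ) (β : ℝ) : ℕ → ℕ → ℝ
  | 0, 0 => 1
  | 0, _ + 1 => 0
  | n + 1, 0 =>
      wallenius kB kR β n 0 * (((kR : ℝ) - n) / (β * kB + ((kR : ℝ) - n)))
  | n + 1, j + 1 =>
      wallenius kB kR β n j *
          (β * ((kB : ℝ) - j) / (β * ((kB : ℝ) - j) + ((kR : ℝ) - ((n : ℝ) - j)))) +
        wallenius kB kR β n (j + 1) *
          (((kR : ℝ) - ((n : ℝ) - (j + 1))) /
            (β * ((kB : ℝ) - (j + 1)) + ((kR : ℝ) - ((n : ℝ) - (j + 1)))))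

/-- The two-layer reduced degree distribution `π'_β([iB iR], [lB lR])`. -/
def reducedDegreeDist (kB kR : ℕ) (π : PMF ℕ) (β : ℝ) (iB iR lB lR : ℕ) : ℝ :=
  if (iB ≤ lB ∧ lB ≤ kB) ∧ (iR ≤ lR ∧ lR ≤ kR) then
    ∑ i ∈ Finset.Icc (iB + iR) (iB + iR + (kB + kR - (lB + lR))),
      (π i).toReal *
        ∑ j ∈ (Finset.HasAntidiagonal.antidiagonal i).filter (fun j => iB ≤ j.1 ∧ iR ≤ j.2),
          wallenius kB kR β i j.1 *
            (((lB.choose iB : ℝ) * ((kB - lB).choose (j.1 - iB) : ℝ) / (kB.choose j.1 : ℝ)) *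
              ((lR.choose iR : ℝ) * ((kR - lR).choose (j.2 - iR) : ℝ) / (kR.choose j.2 : ℝ)))
  else 0

/-! ### Transmission with feedback -/

/-- The parameter in force at the encoder: `β` in phase 1, i.e. as long as the base layer is not
decoded, and `0` (refinement layer only) after the feedback, in phase 2. -/
def encoderParameter {kB kR : ℕ} (β : ℝ≥0) (s : Receiver kB kR) : ℝ≥0 :=
  if s.state.lB ≠ 0 then β else 0

/-- A reception: the receiver at the time of arrival, and the arriving output symbol. -/
abbrev Reception (kB kR : ℕ) : Type := Receiver kB kR × OutputSymbol kB kR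

open Classical in
/-- The transmission when at most `n` output symbols are collected: law of the chronological list
of receptions, together with the final receiver. After each reception decoding is attempted;
the feedback is immediate and error-free; transmission ends when all input symbols are decoded. -/
def transmission (kB kR : ℕ) (π : PMF ℕ) (β : ℝ≥0) :
    ℕ → PMF (List (Reception kB kR) × Receiver kB kR)
  | 0 => PMF.pure ([], start kB kR)
  | n + 1 => (transmission kB kR π β n).bind fun ω =>
      if ω.2.unprocessed = ∅ then PMF.pure ω
      else (encode kB kR π (encoderParameter β ω.2)).bind fun c =>
        (decode (receive ω.2 {c})).map fun s => (ω.1 ++ [(ω.2, c)], s)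

/-- An arriving symbol is redundant when its reduced degree is zero. -/
def Reception.Redundant {kB kR : ℕ} (x : Reception kB kR) : Prop :=
  x.2.2 ∩ x.1.unprocessed = ∅

/-- Expectation under a discrete law. -/
def expect {Ω : Type*} (p : PMF Ω) (X : Ω → ℕ) : ℝ := ∑' ω, (p ω).toReal * (X ω : ℝ)

open Classical in
/-- Expected number of symbols with reduced degree zero, when at most `n` symbols are collected. -/
def expectedRedundancy (kB kR : ℕ) (π : PMF ℕ) (β : ℝ≥0) (n : ℕ) : ℝ :=
  expect (transmission kB kR π β n) fun ω => ω.1.countP fun x => decide x.Redundant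

open Classical in
/-- Expected number of symbols received in phase 1 because decoding of the first `Δ` symbols,
for some `1 ≤ Δ ≤ N`, failed in the state `d`. The first symbol of all (`drop 1`) precedes any
decoding attempt. -/
def expectedReceived₁ (kB kR : ℕ) (π : PMF ℕ) (β : ℝ≥0) (N : ℕ) (d : DecoderState) : ℝ :=
  expect (transmission kB kR π β (N + 1)) fun ω =>
    (ω.1.drop 1).countP fun x => decide (x.1.state.lB ≠ 0 ∧ x.1.state = d)

open Classical in
/-- Expected number of symbols received in phase 2 because decoding of the first `Δ` symbols,
for some `1 ≤ Δ ≤ N`, failed in the state `d`. -/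
def expectedReceived₂ (kB kR : ℕ) (π : PMF ℕ) (β : ℝ≥0) (N : ℕ) (d : DecoderState) : ℝ :=
  expect (transmission kB kR π β (N + 1)) fun ω =>
    (ω.1.drop 1).countP fun x => decide (x.1.state.lB = 0 ∧ x.1.state = d)

/-! ### Terminal state distributions -/

/-- Phase 1, initial receiver: `Δ₁` symbols are collected prior to decoding. -/
def initial₁ (kB kR : ℕ) (π : PMF ℕ) (β : ℝ≥0) (Δ₁ : ℕ) : PMF (Receiver kB kR) :=
  (encodeBatch kB kR π β Δ₁).map (receive (start kB kR))

/-- Phase 1, receiver when decoding of the `Δ₁` collected symbols has stopped. -/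
def final₁ (kB kR : ℕ) (π : PMF ℕ) (β : ℝ≥0) (Δ₁ : ℕ) : PMF (Receiver kB kR) :=
  (initial₁ kB kR π β Δ₁).bind decode

/-- Terminal state distribution `f(d | Δ₁)` of phase 1. -/
def terminalDist₁ (kB kR : ℕ) (π : PMF ℕ) (β : ℝ≥0) (Δ₁ : ℕ) (d : DecoderState) : ℝ≥0∞ :=
  (final₁ kB kR π β Δ₁).map Receiver.state d

/-- Feedback state distribution: probability that decoding of the first `Δ₁ - 1` symbols leaves
base layer symbols undecoded, while after reception of the `Δ₁`-th symbol decoding stops in `s`, in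
which the base layer is decoded. -/
def feedbackDist (kB kR : ℕ) (π : PMF ℕ) (β : ℝ≥0) (Δ₁ : ℕ) (s : Receiver kB kR) : ℝ≥0∞ :=
  if s.state.lB = 0 then
    ∑' s₀ : Receiver kB kR, if s₀.state.lB ≠ 0 then
      final₁ kB kR π β (Δ₁ - 1) s₀ *
        (encode kB kR π β).bind (fun c => decode (receive s₀ {c})) s
    else 0
  else 0

/-- Phase 2, initial receiver: feedback is sent upon the `Δ₁`-th symbol, and `Δ₂ - Δ₁` further
symbols, all from the refinement layer, are collected prior to decoding. -/
def initialDist₂ (kB kR : ℕ) (π : PMF ℕ) (β : ℝ≥0) (Δ₁ Δ₂ : ℕ) (s : Receiver kB kR) : ℝ≥0∞ :=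
  ∑' sF : Receiver kB kR, feedbackDist kB kR π β Δ₁ sF *
    (encodeBatch kB kR π 0 (Δ₂ - Δ₁)).map (receive sF) s

/-- Terminal state distribution `f(d | Δ₁, Δ₂)` of phase 2. As in `initialDist₂`, it is the joint
probability with the event that the feedback is sent upon the `Δ₁`-th symbol. -/
def terminalDist₂ (kB kR : ℕ) (π : PMF ℕ) (β : ℝ≥0) (Δ₁ Δ₂ : ℕ) (d : DecoderState) : ℝ≥0∞ :=
  ∑' s : Receiver kB kR, initialDist₂ kB kR π β Δ₁ Δ₂ s * (decode s).map Receiver.state d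

end URTLT

end

/-! The outcome of peeling does not depend on the order in which ripple symbols are processed: at a
stop, the processed symbols form the least set closed under peeling, `decodable M`, where `M` is
everything received so far. A stopped receiver is thus a deterministic function `finalReceiver M`,
and decoding after every symbol or once for a whole batch gives the same law
(`decode_receive_finalReceiver`). This links the transmission, symbol by symbol, with the batches in
the terminal state distributions.

Observed at its stops, the receiver is a Markov chain whose unprocessed set only shrinks. A receiver
with undecoded base layer is reached through such receivers only, so its probability is the phase 1
batch probability (`receiverLaw_apply_of_lB_ne_zero`). Once the base layer is decoded and while
symbols are still missing, splitting by the time of the feedback gives a sum of phase 2 batch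
probabilities (`receiverLaw_apply_of_lB_eq_zero`).

By linearity, the expected redundancy is a sum, over reception times, of the probability that
transmission is still running and all neighbours of the arriving symbol are already processed.
Symbols within a layer are exchangeable, so a neighbour set has a probability `setProb` depending
only on its size in each layer; counting the sets of processed symbols turns the conditional
probability into the reduced degree distribution at zero (`toReal_mean_encode`), a function of the
state and the phase. Grouping by state gives the formula. The first symbol contributes nothing
because degree zero has probability zero. Sums are rearranged in `ℝ≥0∞`, where they are bounded by
the number of receptions; this yields convergence. -/

namespace URTLT

/-! ### Confluence of the peeling decoder -/

/-- A set of input symbols is closed under peeling if it contains every neighbour of an output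
symbol all of whose other neighbours it contains. -/
def PeelingClosed {kB kR : ℕ} (M : Multiset (OutputSymbol kB kR))
    (P : Finset (InputSymbol kB kR)) : Prop :=
  ∀ c ∈ M, ∀ w ∈ c.2, c.2.erase w ⊆ P → w ∈ P

open Classical in
/-- The input symbols that can be decoded from `M`: the least set closed under peeling. -/
noncomputable def decodable {kB kR : ℕ} (M : Multiset (OutputSymbol kB kR)) :
    Finset (InputSymbol kB kR) :=
  Finset.univ.filter fun v => ∀ P, PeelingClosed M P → v ∈ P

theorem mem_decodable {kB kR : ℕ} {M : Multiset (OutputSymbol kB kR)} {v : InputSymbol kB kR} :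
    v ∈ decodable M ↔ ∀ P, PeelingClosed M P → v ∈ P := by
  simp [decodable]

theorem peelingClosed_decodable {kB kR : ℕ} (M : Multiset (OutputSymbol kB kR)) :
    PeelingClosed M (decodable M) := by
  intro c hc w hw hsub
  rw [mem_decodable]
  intro P hP
  exact hP c hc w hw fun x hx => mem_decodable.1 (hsub hx) P hP

theorem decodable_subset {kB kR : ℕ} {M : Multiset (OutputSymbol kB kR)}
    {P : Finset (InputSymbol kB kR)} (hP : PeelingClosed M P) : decodable M ⊆ P :=
  fun _ hv => mem_decodable.1 hv P hP

theorem decodable_mono {kB kR : ℕ} {M M' : Multiset (OutputSymbol kB kR)} (h : M ≤ M') :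
    decodable M ⊆ decodable M' :=
  decodable_subset fun c hc => peelingClosed_decodable M' c (Multiset.mem_of_le h hc)

theorem decodable_zero {kB kR : ℕ} : decodable (0 : Multiset (OutputSymbol kB kR)) = ∅ :=
  Finset.subset_empty.1 (decodable_subset fun c hc => by simp at hc)

/-- The output symbols `M`, stripped of all input symbols outside `U`. -/
def strip {kB kR : ℕ} (M : Multiset (OutputSymbol kB kR)) (U : Finset (InputSymbol kB kR)) :
    Multiset (OutputSymbol kB kR) :=
  M.map fun c => (c.1, c.2 ∩ U)

/-- The receiver when decoding of the output symbols `M` has stopped. -/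
noncomputable def finalReceiver {kB kR : ℕ} (M : Multiset (OutputSymbol kB kR)) :
    Receiver kB kR where
  unprocessed := (decodable M)ᶜ
  ripple := ∅
  cloud := (strip M (decodable M)ᶜ).filter fun c => 2 ≤ c.2.card

theorem mem_released {kB kR : ℕ} {m : Multiset (OutputSymbol kB kR)} {w : InputSymbol kB kR} :
    w ∈ released m ↔ ∃ c ∈ m, c.2 = {w} := by
  simp [released]

theorem mem_released_strip {kB kR : ℕ} {M : Multiset (OutputSymbol kB kR)}
    {U : Finset (InputSymbol kB kR)} {w : InputSymbol kB kR} :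
    w ∈ released (strip M U) ↔ ∃ c ∈ M, c.2 ∩ U = {w} := by
  simp [mem_released, strip]

theorem mem_of_inter_eq_singleton {α : Type*} [DecidableEq α] {s U : Finset α} {w : α}
    (h : s ∩ U = {w}) : w ∈ s ∧ w ∈ U :=
  Finset.mem_inter.1 (h ▸ Finset.mem_singleton_self w)

theorem notMem_of_mem_erase_of_inter_eq_singleton {α : Type*} [DecidableEq α] {s U : Finset α}
    {w x : α} (h : s ∩ U = {w}) (hx : x ∈ s.erase w) : x ∉ U := by
  intro hxU
  have hx' := Finset.mem_erase.1 hx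
  have : x ∈ s ∩ U := Finset.mem_inter.2 ⟨hx'.2, hxU⟩
  rw [h] at this
  exact hx'.1 (Finset.mem_singleton.1 this)

/-- The receiver `s` may occur while the received output symbols `M` are being decoded. -/
structure Consistent {kB kR : ℕ} (M : Multiset (OutputSymbol kB kR)) (s : Receiver kB kR) :
    Prop where
  cloud_eq : s.cloud = (strip M s.unprocessed).filter fun c => 2 ≤ c.2.card
  ripple_subset : s.ripple ⊆ s.unprocessed
  released_subset : released (strip M s.unprocessed) ⊆ s.ripple
  processed_decodable : ∀ v, v ∉ s.unprocessed → v ∈ decodable M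
  ripple_decodable : ∀ v ∈ s.ripple, v ∈ decodable M

/-- With an empty ripple no stripped output symbol has degree one, so the processed set is closed
under peeling and contains the least such set; `processed_decodable` is the reverse inclusion. -/
theorem Consistent.eq_finalReceiver {kB kR : ℕ} {M : Multiset (OutputSymbol kB kR)}
    {s : Receiver kB kR} (h : Consistent M s) (hr : s.ripple = ∅) : s = finalReceiver M := by
  have hU : s.unprocessed = (decodable M)ᶜ := by
    rw [← compl_inj_iff, compl_compl]
    refine (Finset.Subset.antisymm (decodable_subset ?_) fun v hv =>
      h.processed_decodable v (Finset.mem_compl.1 hv)).symm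
    intro c hc w hw hsub
    rw [Finset.mem_compl]
    intro hwU
    have : w ∈ s.ripple := by
      refine h.released_subset (mem_released_strip.2 ⟨c, hc, ?_⟩)
      ext x
      simp only [Finset.mem_inter, Finset.mem_singleton]
      constructor
      · rintro ⟨hx, hxU⟩
        by_contra hne
        exact Finset.mem_compl.1 (hsub (Finset.mem_erase.2 ⟨hne, hx⟩)) hxU
      · rintro rfl
        exact ⟨hw, hwU⟩
    simp [hr] at this
  have hc := h.cloud_eq
  rw [hU] at hc
  cases s
  simp only at hr hU hc
  simp only [finalReceiver, hr, hU, hc]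

theorem mem_cloud_of_consistent {kB kR : ℕ} {M : Multiset (OutputSymbol kB kR)}
    {s : Receiver kB kR} (h : Consistent M s) {c : OutputSymbol kB kR} :
    c ∈ s.cloud ↔ (∃ c' ∈ M, (c'.1, c'.2 ∩ s.unprocessed) = c) ∧ 2 ≤ c.2.card := by
  rw [h.cloud_eq, Multiset.mem_filter, strip, Multiset.mem_map]

/-- An output symbol of degree one after the removal of `v` either contained `v`, hence was in the
cloud with degree two and is released now, or did not, hence had its neighbour in the ripple
already. A released neighbour is decodable because all its companions are processed. -/
theorem Consistent.process {kB kR : ℕ} {M : Multiset (OutputSymbol kB kR)}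
    {s : Receiver kB kR} (h : Consistent M s) {v : InputSymbol kB kR} (hv : v ∈ s.ripple) :
    Consistent M (process s v) := by
  have hvU := h.ripple_subset hv
  have hvd := h.ripple_decodable v hv
  have hproc : ∀ x, x ∉ s.unprocessed.erase v → x ∈ decodable M := by
    intro x hx
    by_cases hxv : x = v
    · exact hxv ▸ hvd
    · exact h.processed_decodable x fun hxU => hx (Finset.mem_erase.2 ⟨hxv, hxU⟩)
  have hrel : ∀ w, w ∈ released (s.cloud.map fun c => (c.1, c.2.erase v)) →
      w ∈ released (strip M (s.unprocessed.erase v)) := by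
    intro w hw
    obtain ⟨c, hc, hcw⟩ := mem_released.1 hw
    obtain ⟨c₁, hc₁, rfl⟩ := Multiset.mem_map.1 hc
    obtain ⟨⟨c₂, hc₂, rfl⟩, -⟩ := (mem_cloud_of_consistent h).1 hc₁
    refine mem_released_strip.2 ⟨c₂, hc₂, ?_⟩
    rw [← Finset.inter_erase] at hcw
    exact hcw
  refine ⟨?_, ?_, ?_, hproc, ?_⟩
  · simp only [URTLT.process, h.cloud_eq, strip, Multiset.filter_map, Multiset.map_map,
      Multiset.filter_filter]
    simp only [Function.comp_def, Finset.inter_erase]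
    -- Degree at least two after erasing `v` implies the same before, so the old filter is absorbed
    -- by the new one.
    exact congrArg _ (Multiset.filter_congr fun c _ =>
      ⟨fun h => h.1, fun h => ⟨h, h.trans (Finset.card_le_card (Finset.erase_subset _ _))⟩⟩)
  · refine Finset.union_subset (Finset.erase_subset_erase _ h.ripple_subset) fun w hw => ?_
    obtain ⟨c, -, hcw⟩ := mem_released_strip.1 (hrel w hw)
    exact (mem_of_inter_eq_singleton hcw).2
  · intro w hw
    obtain ⟨c, hc, hcw⟩ := mem_released_strip.1 hw
    have hwU := (mem_of_inter_eq_singleton hcw).2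
    simp only [URTLT.process] at hcw hwU ⊢
    rw [Finset.mem_union]
    rw [Finset.inter_erase] at hcw
    by_cases hvc : v ∈ c.2
    · right
      refine mem_released.2 ⟨(c.1, (c.2 ∩ s.unprocessed).erase v), Multiset.mem_map.2
        ⟨(c.1, c.2 ∩ s.unprocessed), (mem_cloud_of_consistent h).2 ⟨⟨c, hc, rfl⟩, ?_⟩, rfl⟩, hcw⟩
      have := Finset.card_erase_add_one (Finset.mem_inter.2 ⟨hvc, hvU⟩)
      rw [hcw, Finset.card_singleton] at this
      exact this.le
    · left
      rw [Finset.erase_eq_of_notMem (by simp [hvc])] at hcw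
      exact Finset.mem_erase.2 ⟨(Finset.mem_erase.1 hwU).1,
        h.released_subset (mem_released_strip.2 ⟨c, hc, hcw⟩)⟩
  · intro w hw
    rcases Finset.mem_union.1 hw with hw | hw
    · exact h.ripple_decodable w (Finset.mem_of_mem_erase hw)
    · obtain ⟨c, hc, hcw⟩ := mem_released_strip.1 (hrel w hw)
      exact peelingClosed_decodable M c hc w (mem_of_inter_eq_singleton hcw).1 fun x hx =>
        hproc x (notMem_of_mem_erase_of_inter_eq_singleton hcw hx)

/-- Since `decodable M` is closed under peeling, no symbol of `M` has reduced degree one; only `M'`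
feeds the ripple. -/
theorem consistent_receive_finalReceiver {kB kR : ℕ} (M M' : Multiset (OutputSymbol kB kR)) :
    Consistent (M + M') (receive (finalReceiver M) M') := by
  have hsub : decodable M ⊆ decodable (M + M') := decodable_mono (Multiset.le_add_right M M')
  refine ⟨?_, ?_, ?_, ?_, ?_⟩
  · simp [receive, finalReceiver, strip]
  · intro w hw
    simp only [receive, finalReceiver, Finset.empty_union] at hw ⊢
    obtain ⟨c, -, hcw⟩ := mem_released_strip.1 hw
    exact (mem_of_inter_eq_singleton hcw).2
  · intro w hw
    obtain ⟨c, hc, hcw⟩ := mem_released_strip.1 hw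
    simp only [receive, finalReceiver, Finset.empty_union] at hcw ⊢
    rcases Multiset.mem_add.1 hc with hc | hc
    · obtain ⟨hwc, hwU⟩ := mem_of_inter_eq_singleton hcw
      refine absurd (peelingClosed_decodable M c hc w hwc fun x hx => ?_) (Finset.mem_compl.1 hwU)
      have := notMem_of_mem_erase_of_inter_eq_singleton hcw hx
      simpa using this
    · exact mem_released_strip.2 ⟨c, hc, hcw⟩
  · intro v hv
    simp only [receive, finalReceiver, Finset.mem_compl, not_not] at hv
    exact hsub hv
  · intro w hw
    simp only [receive, finalReceiver, Finset.empty_union] at hw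
    obtain ⟨c, hc, hcw⟩ := mem_released_strip.1 hw
    refine peelingClosed_decodable _ c (Multiset.mem_add.2 (Or.inr hc)) w
      (mem_of_inter_eq_singleton hcw).1 fun x hx => hsub ?_
    have := notMem_of_mem_erase_of_inter_eq_singleton hcw hx
    simpa using this

/-- A step with nonempty ripple consumes one unprocessed symbol. The count shows that `kB + kR`
steps always end with an empty ripple. -/
theorem Consistent.of_mem_support_decodingSteps {kB kR : ℕ} {M : Multiset (OutputSymbol kB kR)}
    {s : Receiver kB kR} (h : Consistent M s) (n : ℕ) :
    ∀ s' ∈ (decodingSteps s n).support, Consistent M s' ∧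
      (s'.ripple = ∅ ∨ s'.unprocessed.card + n ≤ s.unprocessed.card) := by
  induction n with
  | zero =>
    intro s' hs'
    simp only [decodingSteps, PMF.support_pure, Set.mem_singleton_iff] at hs'
    subst hs'
    exact ⟨h, Or.inr le_rfl⟩
  | succ n ih =>
    intro s' hs'
    simp only [decodingSteps, PMF.mem_support_bind_iff] at hs'
    obtain ⟨s₁, hs₁, hs'⟩ := hs'
    obtain ⟨hc, hcard⟩ := ih s₁ hs₁
    unfold decodingStep at hs'
    split_ifs at hs' with hne
    · simp only [PMF.support_map, PMF.support_uniformOfFinset, Set.mem_image,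
        Finset.mem_coe] at hs'
      obtain ⟨v, hv, rfl⟩ := hs'
      refine ⟨hc.process hv, Or.inr ?_⟩
      have := Finset.card_erase_add_one (hc.ripple_subset hv)
      have := hcard.resolve_left hne.ne_empty
      simp only [URTLT.process]
      omega
    · simp only [PMF.support_pure, Set.mem_singleton_iff] at hs'
      subst hs'
      exact ⟨hc, Or.inl (Finset.not_nonempty_iff_eq_empty.1 hne)⟩

theorem eq_pure_of_forall_mem_support {α : Type*} {p : PMF α} {a : α}
    (h : ∀ x ∈ p.support, x = a) : p = PMF.pure a := by
  have h1 : p a = 1 := by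
    rw [PMF.apply_eq_one_iff]
    refine Set.eq_singleton_iff_nonempty_unique_mem.2 ⟨p.support_nonempty, h⟩
  ext x
  by_cases hx : x = a
  · simp [hx, h1]
  · rw [PMF.pure_apply, if_neg hx, PMF.apply_eq_zero_iff]
    exact fun hx' => hx (h x hx')

/-- Confluence: every possible outcome is consistent with `M` and has an empty ripple, hence is the
same receiver, and the random choices leave no trace. -/
theorem Consistent.decode_eq {kB kR : ℕ} {M : Multiset (OutputSymbol kB kR)}
    {s : Receiver kB kR} (h : Consistent M s) : decode s = PMF.pure (finalReceiver M) := by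
  refine eq_pure_of_forall_mem_support fun s' hs' => ?_
  obtain ⟨hc, hcard⟩ := h.of_mem_support_decodingSteps _ s' hs'
  refine hc.eq_finalReceiver (hcard.elim id fun hcard => ?_)
  have hk : s.unprocessed.card ≤ kB + kR := by
    simpa using Finset.card_le_univ s.unprocessed
  have : s'.unprocessed = ∅ := Finset.card_eq_zero.1 (by omega)
  exact Finset.subset_empty.1 (this ▸ hc.ripple_subset)

/-- Collecting output symbols one after another or all at once leads to the same receiver. -/
theorem decode_receive_finalReceiver {kB kR : ℕ} (M M' : Multiset (OutputSymbol kB kR)) :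
    decode (receive (finalReceiver M) M') = PMF.pure (finalReceiver (M + M')) :=
  (consistent_receive_finalReceiver M M').decode_eq

theorem start_eq_finalReceiver (kB kR : ℕ) : start kB kR = finalReceiver 0 := by
  simp [start, finalReceiver, decodable_zero, strip]

theorem unprocessed_finalReceiver_anti {kB kR : ℕ} {M M' : Multiset (OutputSymbol kB kR)}
    (h : M ≤ M') : (finalReceiver M').unprocessed ⊆ (finalReceiver M).unprocessed :=
  Finset.compl_subset_compl.2 (decodable_mono h)

theorem isTerminal_finalReceiver {kB kR : ℕ} (M : Multiset (OutputSymbol kB kR)) :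
    (finalReceiver M).state.IsTerminal := by
  simp [finalReceiver, Receiver.state, DecoderState.IsTerminal]

/-! ### Expectations in `ℝ≥0∞` -/

/-- Expectation of an `ℝ≥0∞`-valued function under a discrete law. -/
noncomputable def mean {Ω : Type*} (p : PMF Ω) (f : Ω → ℝ≥0∞) : ℝ≥0∞ := ∑' ω, p ω * f ω

theorem mean_pure {Ω : Type*} (a : Ω) (f : Ω → ℝ≥0∞) : mean (PMF.pure a) f = f a := by
  rw [mean, tsum_eq_single a (fun b hb => by simp [PMF.pure_apply, hb])]
  simp

theorem mean_bind {Ω Ω' : Type*} (p : PMF Ω) (q : Ω → PMF Ω') (f : Ω' → ℝ≥0∞) :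
    mean (p.bind q) f = mean p fun ω => mean (q ω) f := by
  simp only [mean, PMF.bind_apply, ← ENNReal.tsum_mul_right, ← ENNReal.tsum_mul_left]
  rw [ENNReal.tsum_comm]
  simp only [mul_assoc]

theorem mean_map {Ω Ω' : Type*} (p : PMF Ω) (g : Ω → Ω') (f : Ω' → ℝ≥0∞) :
    mean (p.map g) f = mean p fun ω => f (g ω) := by
  rw [PMF.map, mean_bind]
  simp only [Function.comp_apply, mean_pure]

theorem mean_add {Ω : Type*} (p : PMF Ω) (f g : Ω → ℝ≥0∞) :
    mean p (fun ω => f ω + g ω) = mean p f + mean p g := by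
  simp only [mean, mul_add, ENNReal.tsum_add]

theorem mean_const {Ω : Type*} (p : PMF Ω) (a : ℝ≥0∞) : mean p (fun _ => a) = a := by
  rw [mean, ENNReal.tsum_mul_right, p.tsum_coe, one_mul]

theorem mean_mul_const {Ω : Type*} (p : PMF Ω) (f : Ω → ℝ≥0∞) (a : ℝ≥0∞) :
    mean p (fun ω => f ω * a) = mean p f * a := by
  simp only [mean, ← mul_assoc, ENNReal.tsum_mul_right]

theorem mean_tsum {Ω ι : Type*} (p : PMF Ω) (f : ι → Ω → ℝ≥0∞) :
    mean p (fun ω => ∑' i, f i ω) = ∑' i, mean p (f i) := by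
  simp only [mean, ← ENNReal.tsum_mul_left]
  exact ENNReal.tsum_comm

theorem mean_congr {Ω : Type*} {p : PMF Ω} {f g : Ω → ℝ≥0∞} (h : ∀ ω ∈ p.support, f ω = g ω) :
    mean p f = mean p g := by
  refine tsum_congr fun ω => ?_
  by_cases hω : p ω = 0
  · simp [hω]
  · rw [h ω ((p.mem_support_iff ω).2 hω)]

theorem mean_le {Ω : Type*} (p : PMF Ω) {f : Ω → ℝ≥0∞} {a : ℝ≥0∞} (h : ∀ ω, f ω ≤ a) :
    mean p f ≤ a :=
  (ENNReal.tsum_le_tsum fun ω => mul_le_mul_right (h ω) _).trans_eq (mean_const p a)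

open Classical in
theorem map_apply_eq_mean {Ω Ω' : Type*} (p : PMF Ω) (g : Ω → Ω') (b : Ω') :
    p.map g b = mean p fun ω => if g ω = b then 1 else 0 := by
  rw [PMF.map_apply, mean]
  refine tsum_congr fun ω => ?_
  simp [eq_comm]

theorem expect_eq_toReal_mean {Ω : Type*} (p : PMF Ω) (X : Ω → ℕ) :
    expect p X = (mean p fun ω => (X ω : ℝ≥0∞)).toReal := by
  rw [expect, mean, ENNReal.tsum_toReal_eq]
  · simp
  · exact fun ω => ENNReal.mul_ne_top (p.apply_ne_top ω) (ENNReal.natCast_ne_top _)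

theorem coe_countP {α : Type*} (p : α → Prop) [DecidablePred p] (l : List α) :
    ((l.countP fun x => decide (p x) : ℕ) : ℝ≥0∞) =
      (l.map fun x => if p x then (1 : ℝ≥0∞) else 0).sum := by
  induction l with
  | nil => simp
  | cons a l ih =>
    rw [List.countP_cons, List.map_cons, List.sum_cons, ← ih]
    by_cases h : p a <;> simp [h, add_comm]

/-! ### The receiver as a Markov chain -/

/-- The receiver after one more output symbol with law `e` and the ensuing decoding attempt. -/
noncomputable def nextReceiver {kB kR : ℕ} (e : PMF (OutputSymbol kB kR)) (s : Receiver kB kR) :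
    PMF (Receiver kB kR) :=
  e.bind fun c => decode (receive s {c})

open Classical in
/-- Transition law of the receiver in the transmission with feedback. -/
noncomputable def receiverStep {kB kR : ℕ} (π : PMF ℕ) (β : ℝ≥0) (s : Receiver kB kR) :
    PMF (Receiver kB kR) :=
  if s.unprocessed = ∅ then PMF.pure s
  else nextReceiver (encode kB kR π (encoderParameter β s)) s

/-- The receiver when at most `n` output symbols have been collected. -/
noncomputable def receiverLaw (kB kR : ℕ) (π : PMF ℕ) (β : ℝ≥0) (n : ℕ) :
    PMF (Receiver kB kR) :=
  (transmission kB kR π β n).map Prod.snd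

theorem receiverLaw_zero (kB kR : ℕ) (π : PMF ℕ) (β : ℝ≥0) :
    receiverLaw kB kR π β 0 = PMF.pure (start kB kR) := by
  rw [receiverLaw, transmission, PMF.pure_map]

theorem receiverLaw_succ (kB kR : ℕ) (π : PMF ℕ) (β : ℝ≥0) (n : ℕ) :
    receiverLaw kB kR π β (n + 1) = (receiverLaw kB kR π β n).bind (receiverStep π β) := by
  rw [receiverLaw, transmission, PMF.map_bind, receiverLaw, PMF.bind_map]
  congr 1
  funext ω
  simp only [Function.comp_apply, receiverStep]
  split_ifs
  · rw [PMF.pure_map]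
  · simp only [nextReceiver, PMF.map_bind, PMF.map_comp]
    congr 1
    funext c
    exact PMF.map_id _

theorem length_le_of_mem_support {kB kR : ℕ} {π : PMF ℕ} {β : ℝ≥0} (n : ℕ) :
    ∀ ω ∈ (transmission kB kR π β n).support, ω.1.length ≤ n := by
  induction n with
  | zero => simp [transmission]
  | succ n ih =>
    intro ω hω
    simp only [transmission, PMF.mem_support_bind_iff] at hω
    obtain ⟨ω₀, h₀, hω⟩ := hω
    have := ih ω₀ h₀
    split_ifs at hω
    · simp only [PMF.support_pure, Set.mem_singleton_iff] at hω
      subst hω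
      omega
    · simp only [PMF.mem_support_bind_iff, PMF.support_map, Set.mem_image] at hω
      obtain ⟨c, -, s, -, rfl⟩ := hω
      simpa using this

theorem start_state_lB (kB kR : ℕ) : (start kB kR).state.lB = kB := by
  have : (Finset.univ.filter fun v : InputSymbol kB kR => v.isLeft = true) =
      Finset.univ.map Function.Embedding.inl := by
    ext v
    cases v <;> simp
  simp [start, Receiver.state, this]

theorem start_unprocessed_ne_empty {kB : ℕ} (kR : ℕ) (hkB : 0 < kB) :
    (start kB kR).unprocessed ≠ ∅ :=
  Finset.ne_empty_of_mem (Finset.mem_univ (Sum.inl ⟨0, hkB⟩))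

/-- A nonempty base layer forces a first reception. This lets `drop 1` commute with appending later
receptions. -/
theorem one_le_length_of_mem_support {kB kR : ℕ} {π : PMF ℕ} {β : ℝ≥0} (hkB : 0 < kB) (n : ℕ) :
    ∀ ω ∈ (transmission kB kR π β (n + 1)).support, 1 ≤ ω.1.length := by
  induction n with
  | zero =>
    intro ω hω
    simp only [transmission, PMF.pure_bind, start_unprocessed_ne_empty kR hkB, if_false,
      PMF.mem_support_bind_iff, PMF.support_map, Set.mem_image] at hω
    obtain ⟨c, -, s, -, rfl⟩ := hω
    simp
  | succ n ih =>
    intro ω hω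
    rw [transmission] at hω
    simp only [PMF.mem_support_bind_iff] at hω
    obtain ⟨ω₀, h₀, hω⟩ := hω
    have := ih ω₀ h₀
    split_ifs at hω
    · simp only [PMF.support_pure, Set.mem_singleton_iff] at hω
      subst hω
      exact this
    · simp only [PMF.mem_support_bind_iff, PMF.support_map, Set.mem_image] at hω
      obtain ⟨c, -, s, -, rfl⟩ := hω
      simp

open Classical in
-- A running transmission appends exactly one reception, whose law given the past depends on the
-- current receiver only; by `ht` the first `t` entries are already present.
theorem mean_transmission_succ {kB kR : ℕ} {π : PMF ℕ} {β : ℝ≥0} {t n : ℕ}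
    (ht : ∀ ω ∈ (transmission kB kR π β n).support, t ≤ ω.1.length)
    (Q : Reception kB kR → ℝ≥0∞) :
    mean (transmission kB kR π β (n + 1)) (fun ω => ((ω.1.drop t).map Q).sum) =
      mean (transmission kB kR π β n) (fun ω => ((ω.1.drop t).map Q).sum) +
        mean (receiverLaw kB kR π β n) (fun s => if s.unprocessed = ∅ then 0 else
          mean (encode kB kR π (encoderParameter β s)) fun c => Q (s, c)) := by
  rw [receiverLaw, mean_map, ← mean_add, transmission, mean_bind]
  refine mean_congr fun ω hω => ?_
  split_ifs with h
  · rw [mean_pure, add_zero]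
  · rw [mean_bind]
    simp only [mean_map, List.drop_append_of_le_length (ht ω hω), List.map_append, List.sum_append,
      List.map_cons, List.map_nil, List.sum_singleton, mean_const, mean_add]

open Classical in
/-- Expected total of `Q` over all receptions but the first `t ≤ 1` ones. -/
theorem mean_transmission {kB kR : ℕ} {π : PMF ℕ} {β : ℝ≥0} (hkB : 0 < kB) {t n : ℕ}
    (ht : t ≤ 1) (hn : t ≤ n) (Q : Reception kB kR → ℝ≥0∞) :
    mean (transmission kB kR π β n) (fun ω => ((ω.1.drop t).map Q).sum) =
      ∑ m ∈ Finset.Ico t n, mean (receiverLaw kB kR π β m) (fun s =>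
        if s.unprocessed = ∅ then 0 else
          mean (encode kB kR π (encoderParameter β s)) fun c => Q (s, c)) := by
  induction n, hn using Nat.le_induction with
  | base =>
    rw [Finset.Ico_self, Finset.sum_empty, ← mean_const (transmission kB kR π β t) 0]
    refine mean_congr fun ω hω => ?_
    rw [List.drop_eq_nil_of_le (length_le_of_mem_support t ω hω)]
    simp
  | succ n hn ih =>
    rw [mean_transmission_succ, ih, Finset.sum_Ico_succ_top hn]
    intro ω hω
    cases n with
    | zero => omega
    | succ n => exact ht.trans (one_le_length_of_mem_support hkB n ω hω)

/-! ### Reachable receivers -/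

theorem nextReceiver_finalReceiver {kB kR : ℕ} (e : PMF (OutputSymbol kB kR))
    (M : Multiset (OutputSymbol kB kR)) :
    nextReceiver e (finalReceiver M) = e.map fun c => finalReceiver (c ::ₘ M) := by
  simp only [nextReceiver, decode_receive_finalReceiver, PMF.map, Function.comp_def]
  simp only [Multiset.add_comm M, Multiset.singleton_add]

theorem of_mem_support_nextReceiver {kB kR : ℕ} {e : PMF (OutputSymbol kB kR)}
    {s s' : Receiver kB kR} (hs : s ∈ Set.range finalReceiver)
    (h : s' ∈ (nextReceiver e s).support) :
    s' ∈ Set.range (finalReceiver (kB := kB) (kR := kR)) ∧ s'.unprocessed ⊆ s.unprocessed := by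
  obtain ⟨M, rfl⟩ := hs
  rw [nextReceiver_finalReceiver] at h
  simp only [PMF.support_map, Set.mem_image] at h
  obtain ⟨c, -, rfl⟩ := h
  exact ⟨⟨_, rfl⟩, unprocessed_finalReceiver_anti (Multiset.le_cons_self M c)⟩

theorem nextReceiver_apply_eq_zero {kB kR : ℕ} {e : PMF (OutputSymbol kB kR)}
    {s s' : Receiver kB kR} (hs : s ∈ Set.range finalReceiver)
    (h : ¬ s'.unprocessed ⊆ s.unprocessed) : nextReceiver e s s' = 0 := by
  by_contra hne
  exact h (of_mem_support_nextReceiver hs ((PMF.mem_support_iff _ _).2 hne)).2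

theorem state_lB_mono {kB kR : ℕ} {s s' : Receiver kB kR} (h : s'.unprocessed ⊆ s.unprocessed) :
    s'.state.lB ≤ s.state.lB :=
  Finset.card_le_card (Finset.filter_subset_filter _ h)

theorem unprocessed_ne_empty_of_lB_ne_zero {kB kR : ℕ} {s : Receiver kB kR}
    (h : s.state.lB ≠ 0) : s.unprocessed ≠ ∅ := by
  intro h'
  simp [Receiver.state, h'] at h

theorem unprocessed_ne_empty_of_lR_ne_zero {kB kR : ℕ} {s : Receiver kB kR}
    (h : s.state.lR ≠ 0) : s.unprocessed ≠ ∅ := by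
  intro h'
  simp [Receiver.state, h'] at h

theorem lR_ne_zero_of_unprocessed_ne_empty {kB kR : ℕ} {s : Receiver kB kR}
    (h : s.unprocessed ≠ ∅) (hB : s.state.lB = 0) : s.state.lR ≠ 0 := by
  obtain ⟨v, hv⟩ := Finset.nonempty_iff_ne_empty.2 h
  rw [Receiver.state, Finset.card_eq_zero, Finset.filter_eq_empty_iff] at hB
  have := hB hv
  refine Finset.card_ne_zero_of_mem (Finset.mem_filter.2 ⟨hv, ?_⟩)
  simpa using this

theorem receiverLaw_support {kB kR : ℕ} {π : PMF ℕ} {β : ℝ≥0} (n : ℕ) :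
    (receiverLaw kB kR π β n).support ⊆ Set.range finalReceiver := by
  induction n with
  | zero =>
    rw [receiverLaw_zero, PMF.support_pure, Set.singleton_subset_iff]
    exact ⟨0, (start_eq_finalReceiver kB kR).symm⟩
  | succ n ih =>
    intro s hs
    rw [receiverLaw_succ, PMF.mem_support_bind_iff] at hs
    obtain ⟨s₀, h₀, hs⟩ := hs
    unfold receiverStep at hs
    split_ifs at hs
    · simp only [PMF.support_pure, Set.mem_singleton_iff] at hs
      exact hs ▸ ih h₀
    · exact (of_mem_support_nextReceiver (ih h₀) hs).1

/-- Decoding of a batch received in a stopped decoder. -/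
noncomputable def batchReceiver {kB kR : ℕ} (π : PMF ℕ) (β : ℝ≥0) (n : ℕ) (s : Receiver kB kR) :
    PMF (Receiver kB kR) :=
  ((encodeBatch kB kR π β n).map (receive s)).bind decode

theorem batchReceiver_finalReceiver {kB kR : ℕ} (π : PMF ℕ) (β : ℝ≥0) (n : ℕ)
    (M : Multiset (OutputSymbol kB kR)) :
    batchReceiver π β n (finalReceiver M) =
      (encodeBatch kB kR π β n).map fun M' => finalReceiver (M + M') := by
  rw [batchReceiver, PMF.bind_map]
  simp only [Function.comp_def, decode_receive_finalReceiver, PMF.map]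

theorem batchReceiver_zero {kB kR : ℕ} (π : PMF ℕ) (β : ℝ≥0) {s : Receiver kB kR}
    (hs : s ∈ Set.range finalReceiver) : batchReceiver π β 0 s = PMF.pure s := by
  obtain ⟨M, rfl⟩ := hs
  simp [batchReceiver_finalReceiver, encodeBatch, PMF.pure_map]

theorem batchReceiver_succ {kB kR : ℕ} (π : PMF ℕ) (β : ℝ≥0) (n : ℕ) {s : Receiver kB kR}
    (hs : s ∈ Set.range finalReceiver) :
    batchReceiver π β (n + 1) s =
      (batchReceiver π β n s).bind (nextReceiver (encode kB kR π β)) := by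
  obtain ⟨M, rfl⟩ := hs
  simp only [batchReceiver_finalReceiver, encodeBatch, PMF.map_bind, PMF.bind_map,
    Function.comp_def, nextReceiver_finalReceiver, PMF.map_comp, Multiset.add_cons]

theorem of_mem_support_batchReceiver {kB kR : ℕ} {π : PMF ℕ} {β : ℝ≥0} {n : ℕ}
    {s s' : Receiver kB kR} (hs : s ∈ Set.range finalReceiver)
    (h : s' ∈ (batchReceiver π β n s).support) :
    s' ∈ Set.range (finalReceiver (kB := kB) (kR := kR)) ∧ s'.unprocessed ⊆ s.unprocessed := by
  obtain ⟨M, rfl⟩ := hs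
  rw [batchReceiver_finalReceiver] at h
  simp only [PMF.support_map, Set.mem_image] at h
  obtain ⟨M', -, rfl⟩ := h
  exact ⟨⟨_, rfl⟩, unprocessed_finalReceiver_anti (Multiset.le_add_right M M')⟩

/-! ### Phase 1 -/

theorem start_mem_range (kB kR : ℕ) : start kB kR ∈ Set.range finalReceiver :=
  ⟨0, (start_eq_finalReceiver kB kR).symm⟩

theorem final₁_zero (kB kR : ℕ) (π : PMF ℕ) (β : ℝ≥0) :
    final₁ kB kR π β 0 = PMF.pure (start kB kR) :=
  batchReceiver_zero π β (start_mem_range kB kR)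

theorem final₁_succ (kB kR : ℕ) (π : PMF ℕ) (β : ℝ≥0) (n : ℕ) :
    final₁ kB kR π β (n + 1) =
      (final₁ kB kR π β n).bind (nextReceiver (encode kB kR π β)) :=
  batchReceiver_succ π β n (start_mem_range kB kR)

theorem final₁_apply_eq_zero {kB kR : ℕ} {π : PMF ℕ} {β : ℝ≥0} {n : ℕ} {s : Receiver kB kR}
    (hs : s ∉ Set.range finalReceiver) : final₁ kB kR π β n s = 0 := by
  by_contra h
  exact hs (of_mem_support_batchReceiver (start_mem_range kB kR)
    ((PMF.mem_support_iff _ _).2 h)).1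

theorem receiverLaw_apply_eq_zero {kB kR : ℕ} {π : PMF ℕ} {β : ℝ≥0} {n : ℕ} {s : Receiver kB kR}
    (hs : s ∉ Set.range finalReceiver) : receiverLaw kB kR π β n s = 0 := by
  by_contra h
  exact hs (receiverLaw_support n ((PMF.mem_support_iff _ _).2 h))

theorem receiverStep_of_lB_ne_zero {kB kR : ℕ} {π : PMF ℕ} {β : ℝ≥0} {s : Receiver kB kR}
    (h : s.state.lB ≠ 0) : receiverStep π β s = nextReceiver (encode kB kR π β) s := by
  rw [receiverStep, if_neg (unprocessed_ne_empty_of_lB_ne_zero h), encoderParameter, if_pos h]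

theorem receiverStep_apply_eq_zero {kB kR : ℕ} {π : PMF ℕ} {β : ℝ≥0} {s s' : Receiver kB kR}
    (hs : s ∈ Set.range finalReceiver)
    (h : ¬ s'.unprocessed ⊆ s.unprocessed) : receiverStep π β s s' = 0 := by
  unfold receiverStep
  split_ifs
  · rw [PMF.pure_apply, if_neg]
    rintro rfl
    exact h (Finset.Subset.refl _)
  · exact nextReceiver_apply_eq_zero hs h

/-- As long as the base layer is not decoded, the feedback makes no difference. -/
theorem receiverLaw_apply_of_lB_ne_zero {kB kR : ℕ} {π : PMF ℕ} {β : ℝ≥0} (n : ℕ) :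
    ∀ s : Receiver kB kR, s.state.lB ≠ 0 → receiverLaw kB kR π β n s = final₁ kB kR π β n s := by
  induction n with
  | zero =>
    intro s _
    rw [receiverLaw_zero, final₁_zero]
  | succ n ih =>
    intro s hs
    rw [receiverLaw_succ, final₁_succ, PMF.bind_apply, PMF.bind_apply]
    refine tsum_congr fun s₀ => ?_
    by_cases h₀ : s₀ ∈ Set.range finalReceiver
    · by_cases hB : s₀.state.lB = 0
      -- After the feedback the two chains use different parameters, but neither can return to an
      -- undecoded base layer.
      · have hsub : ¬ s.unprocessed ⊆ s₀.unprocessed := fun h =>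
          hs (Nat.le_zero.1 (hB ▸ state_lB_mono h))
        rw [receiverStep_apply_eq_zero h₀ hsub, nextReceiver_apply_eq_zero h₀ hsub,
          mul_zero, mul_zero]
      · rw [ih s₀ hB, receiverStep_of_lB_ne_zero hB]
    · rw [receiverLaw_apply_eq_zero h₀, final₁_apply_eq_zero h₀, zero_mul, zero_mul]

/-! ### Phase 2 -/

/-- Joint probability that the feedback is sent upon the `Δ₁`-th symbol and that decoding stops in
the receiver `s` upon the `Δ₂`-th symbol. -/
noncomputable def finalDist₂ (kB kR : ℕ) (π : PMF ℕ) (β : ℝ≥0) (Δ₁ Δ₂ : ℕ)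
    (s : Receiver kB kR) : ℝ≥0∞ :=
  ∑' sF : Receiver kB kR, feedbackDist kB kR π β Δ₁ sF * batchReceiver π 0 (Δ₂ - Δ₁) sF s

theorem of_feedbackDist_ne_zero {kB kR : ℕ} {π : PMF ℕ} {β : ℝ≥0} {Δ₁ : ℕ} {s : Receiver kB kR}
    (h : feedbackDist kB kR π β Δ₁ s ≠ 0) :
    s ∈ Set.range (finalReceiver (kB := kB) (kR := kR)) ∧ s.state.lB = 0 := by
  unfold feedbackDist at h
  split_ifs at h with hB
  · refine ⟨?_, hB⟩
    obtain ⟨s₀, h₀⟩ := not_forall.1 (ENNReal.tsum_eq_zero.not.1 h)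
    split_ifs at h₀ with hB₀
    · obtain ⟨h1, h2⟩ := mul_ne_zero_iff.1 h₀
      have hr : s₀ ∈ Set.range (finalReceiver (kB := kB) (kR := kR)) := by
        by_contra hs
        exact h1 (final₁_apply_eq_zero hs)
      exact (of_mem_support_nextReceiver hr ((PMF.mem_support_iff _ _).2 h2)).1
    · exact absurd rfl h₀
  · exact absurd rfl h

theorem of_finalDist₂_ne_zero {kB kR : ℕ} {π : PMF ℕ} {β : ℝ≥0} {Δ₁ Δ₂ : ℕ}
    {s : Receiver kB kR} (h : finalDist₂ kB kR π β Δ₁ Δ₂ s ≠ 0) :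
    s ∈ Set.range (finalReceiver (kB := kB) (kR := kR)) ∧ s.state.lB = 0 := by
  obtain ⟨sF, hF⟩ : ∃ sF, feedbackDist kB kR π β Δ₁ sF * batchReceiver π 0 (Δ₂ - Δ₁) sF s ≠ 0 := by
    by_contra! hz
    exact h (ENNReal.tsum_eq_zero.2 hz)
  obtain ⟨h1, h2⟩ := mul_ne_zero_iff.1 hF
  obtain ⟨hr, hB⟩ := of_feedbackDist_ne_zero h1
  obtain ⟨hr', hsub⟩ := of_mem_support_batchReceiver hr ((PMF.mem_support_iff _ _).2 h2)
  exact ⟨hr', Nat.le_zero.1 (hB ▸ state_lB_mono hsub)⟩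

theorem finalDist₂_self {kB kR : ℕ} (π : PMF ℕ) (β : ℝ≥0) (Δ : ℕ) (s : Receiver kB kR) :
    finalDist₂ kB kR π β Δ Δ s = feedbackDist kB kR π β Δ s := by
  have h : ∀ sF, feedbackDist kB kR π β Δ sF * batchReceiver π 0 (Δ - Δ) sF s =
      feedbackDist kB kR π β Δ sF * PMF.pure sF s := by
    intro sF
    by_cases hF : feedbackDist kB kR π β Δ sF = 0
    · rw [hF, zero_mul, zero_mul]
    · rw [Nat.sub_self, batchReceiver_zero π 0 (of_feedbackDist_ne_zero hF).1]
  rw [finalDist₂, tsum_congr h, tsum_eq_single s]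
  · simp
  · intro sF hF
    rw [PMF.pure_apply, if_neg hF.symm, mul_zero]

theorem finalDist₂_succ {kB kR : ℕ} (π : PMF ℕ) (β : ℝ≥0) {Δ₁ Δ₂ : ℕ} (h : Δ₁ ≤ Δ₂)
    (s : Receiver kB kR) :
    finalDist₂ kB kR π β Δ₁ (Δ₂ + 1) s =
      ∑' s₀, finalDist₂ kB kR π β Δ₁ Δ₂ s₀ * nextReceiver (encode kB kR π 0) s₀ s := by
  simp only [finalDist₂, ← ENNReal.tsum_mul_right]
  rw [ENNReal.tsum_comm]
  refine tsum_congr fun sF => ?_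
  simp only [mul_assoc, ENNReal.tsum_mul_left]
  by_cases hF : feedbackDist kB kR π β Δ₁ sF = 0
  · rw [hF, zero_mul, zero_mul]
  · rw [Nat.sub_add_comm h, batchReceiver_succ π 0 _ (of_feedbackDist_ne_zero hF).1,
      PMF.bind_apply]

open Classical in
theorem terminalDist₂_eq_tsum {kB kR : ℕ} (π : PMF ℕ) (β : ℝ≥0) (Δ₁ Δ₂ : ℕ) (d : DecoderState) :
    terminalDist₂ kB kR π β Δ₁ Δ₂ d =
      ∑' s, finalDist₂ kB kR π β Δ₁ Δ₂ s * if s.state = d then 1 else 0 := by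
  simp only [terminalDist₂, initialDist₂, finalDist₂, ← ENNReal.tsum_mul_right]
  conv_lhs => rw [ENNReal.tsum_comm]
  conv_rhs => rw [ENNReal.tsum_comm]
  refine tsum_congr fun sF => ?_
  simp only [mul_assoc, ENNReal.tsum_mul_left]
  congr 1
  simp only [map_apply_eq_mean (decode _)]
  exact (mean_bind _ _ _).symm

/-- Decomposition of phase 2 by the time of the feedback. -/
theorem receiverLaw_apply_of_lB_eq_zero {kB kR : ℕ} {π : PMF ℕ} {β : ℝ≥0} (hkB : 0 < kB) (n : ℕ) :
    ∀ s : Receiver kB kR, s.state.lB = 0 → s.unprocessed ≠ ∅ →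
      receiverLaw kB kR π β n s = ∑ Δ ∈ Finset.Icc 1 n, finalDist₂ kB kR π β Δ n s := by
  induction n with
  | zero =>
    intro s hs _
    rw [receiverLaw_zero, PMF.pure_apply, if_neg]
    · simp
    · rintro rfl
      rw [start_state_lB] at hs
      omega
  | succ n ih =>
    intro s hs hne
    -- Feedback sent by time `n`: one further step with parameter `0`. The remaining term, feedback
    -- upon symbol `n + 1`, collects the transitions from receivers with undecoded base layer.
    have hrec : ∑ Δ ∈ Finset.Icc 1 n, finalDist₂ kB kR π β Δ (n + 1) s =
        ∑' s₀, (∑ Δ ∈ Finset.Icc 1 n, finalDist₂ kB kR π β Δ n s₀) *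
          nextReceiver (encode kB kR π 0) s₀ s := by
      simp only [Finset.sum_mul]
      rw [Summable.tsum_finsetSum fun _ _ => ENNReal.summable]
      exact Finset.sum_congr rfl fun Δ hΔ => finalDist₂_succ π β (Finset.mem_Icc.1 hΔ).2 s
    rw [Finset.sum_Icc_succ_top (by omega), hrec, finalDist₂_self, feedbackDist, if_pos hs,
      Nat.add_sub_cancel, receiverLaw_succ, PMF.bind_apply, ← ENNReal.tsum_add]
    refine tsum_congr fun s₀ => ?_
    have hzero : ∀ Δ, ¬ (s₀ ∈ Set.range (finalReceiver (kB := kB) (kR := kR)) ∧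
        s₀.state.lB = 0) → finalDist₂ kB kR π β Δ n s₀ = 0 := by
      intro Δ h
      by_contra hne
      exact h (of_finalDist₂_ne_zero hne)
    by_cases h₀ : s₀ ∈ Set.range finalReceiver
    · by_cases hB : s₀.state.lB = 0
      · rw [if_neg (not_not.2 hB), add_zero]
        -- The transmission halts at a completed receiver whereas `finalDist₂` keeps collecting
        -- symbols; neither leads to `s`, which has unprocessed symbols.
        by_cases hU : s₀.unprocessed = ∅
        · have hsub : ¬ s.unprocessed ⊆ s₀.unprocessed := fun h =>
            hne (Finset.subset_empty.1 (hU ▸ h))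
          rw [receiverStep_apply_eq_zero h₀ hsub, nextReceiver_apply_eq_zero h₀ hsub,
            mul_zero, mul_zero]
        · rw [ih s₀ hB hU, receiverStep, if_neg hU, encoderParameter, if_neg (not_not.2 hB)]
      · rw [if_pos hB, Finset.sum_eq_zero fun Δ _ => hzero Δ fun h => hB h.2, zero_mul, zero_add,
          receiverLaw_apply_of_lB_ne_zero n s₀ hB, receiverStep_of_lB_ne_zero hB]
        rfl
    · rw [receiverLaw_apply_eq_zero h₀, final₁_apply_eq_zero h₀,
        Finset.sum_eq_zero fun Δ _ => hzero Δ fun h => h₀ h.1]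
      simp

/-! ### Law of the neighbours of an output symbol -/

/-- Total weight of the input symbols not in `S`. -/
noncomputable def totalRemaining {kB kR : ℕ} (β : ℝ≥0) (S : Finset (InputSymbol kB kR)) : ℝ≥0∞ :=
  ∑' v, remainingWeight β S v

theorem totalRemaining_eq {kB kR : ℕ} (β : ℝ≥0) (S : Finset (InputSymbol kB kR)) :
    totalRemaining β S =
      β * ((kB - S.toLeft.card : ℕ) : ℝ≥0∞) + ((kR - S.toRight.card : ℕ) : ℝ≥0∞) := by
  have hL : (Finset.univ.filter fun x : Fin kB => Sum.inl x ∉ S) = (S.toLeft)ᶜ := by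
    ext; simp
  have hR : (Finset.univ.filter fun x : Fin kR => Sum.inr x ∉ S) = (S.toRight)ᶜ := by
    ext; simp
  rw [totalRemaining, tsum_fintype, Fintype.sum_sum_type]
  simp only [remainingWeight, weight, Sum.elim_inl, Sum.elim_inr]
  congr 1
  · rw [Finset.sum_ite, Finset.sum_const_zero, zero_add, hL, Finset.sum_const, Finset.card_compl,
      Fintype.card_fin, nsmul_eq_mul, mul_comm]
  · rw [Finset.sum_ite, Finset.sum_const_zero, zero_add, hR, Finset.sum_const, Finset.card_compl,
      Fintype.card_fin, nsmul_eq_mul, ENNReal.coe_one, mul_one]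

theorem card_toLeft_le {kB kR : ℕ} (S : Finset (InputSymbol kB kR)) : S.toLeft.card ≤ kB := by
  simpa using Finset.card_le_univ S.toLeft

theorem card_toRight_le {kB kR : ℕ} (S : Finset (InputSymbol kB kR)) : S.toRight.card ≤ kR := by
  simpa using Finset.card_le_univ S.toRight

theorem toReal_totalRemaining {kB kR : ℕ} (β : ℝ≥0) (S : Finset (InputSymbol kB kR)) :
    (totalRemaining β S).toReal =
      (β : ℝ) * ((kB : ℝ) - S.toLeft.card) + ((kR : ℝ) - S.toRight.card) := by
  have hL := card_toLeft_le S
  have hR := card_toRight_le S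
  rw [totalRemaining_eq, ENNReal.toReal_add (by finiteness) (by finiteness)]
  simp [hL, hR]

/-- `i` input symbols of positive weight can be selected. -/
def Selectable (kB kR : ℕ) (β : ℝ≥0) (i : ℕ) : Prop := i ≤ kB + kR ∧ (β = 0 → i ≤ kR)

theorem totalRemaining_ne_zero {kB kR : ℕ} {β : ℝ≥0} {i : ℕ} (hi : Selectable kB kR β (i + 1))
    {S : Finset (InputSymbol kB kR)} (hS : S.card = i) : totalRemaining β S ≠ 0 := by
  have hc := S.card_toLeft_add_card_toRight
  rw [totalRemaining_eq]
  intro h0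
  obtain ⟨h1, h2⟩ := add_eq_zero.1 h0
  rw [Nat.cast_eq_zero] at h2
  rcases mul_eq_zero.1 h1 with h1 | h1
  · have := hi.2 (by simpa using h1)
    omega
  · rw [Nat.cast_eq_zero] at h1
    have := hi.1
    omega

open Classical in
theorem selectOne_apply {kB kR : ℕ} {β : ℝ≥0} {S : Finset (InputSymbol kB kR)}
    (h : totalRemaining β S ≠ 0) (T : Finset (InputSymbol kB kR)) :
    selectOne β S T = ∑ v, if v ∉ S ∧ insert v S = T then
      (weight β v : ℝ≥0∞) * (totalRemaining β S)⁻¹ else 0 := by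
  have h' : ∑' v, remainingWeight β S v ≠ 0 := h
  rw [selectOne, dif_neg h', map_apply_eq_mean, mean, tsum_fintype]
  refine Finset.sum_congr rfl fun v _ => ?_
  rw [PMF.normalize_apply, remainingWeight]
  by_cases h1 : v ∈ S <;> by_cases h2 : insert v S = T <;> simp [h1, h2, totalRemaining]

/-- The sum is over the symbol `v` selected last. The hypothesis rules out the branch of `selectOne`
in which nothing is added. -/
theorem selectNeighbours_succ_apply {kB kR : ℕ} {β : ℝ≥0} {i : ℕ}
    (h : ∀ S : Finset (InputSymbol kB kR), selectNeighbours β i S ≠ 0 → totalRemaining β S ≠ 0)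
    (T : Finset (InputSymbol kB kR)) :
    selectNeighbours β (i + 1) T = ∑ v ∈ T, selectNeighbours β i (T.erase v) *
      ((weight β v : ℝ≥0∞) * (totalRemaining β (T.erase v))⁻¹) := by
  classical
  have h1 : ∀ S, selectNeighbours β i S * selectOne β S T = ∑ v, if v ∉ S ∧ insert v S = T then
      selectNeighbours β i S * ((weight β v : ℝ≥0∞) * (totalRemaining β S)⁻¹) else 0 := by
    intro S
    by_cases hS : selectNeighbours β i S = 0
    · simp [hS]
    · rw [selectOne_apply (h S hS), Finset.mul_sum]
      simp only [mul_ite, mul_zero]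
  rw [selectNeighbours, PMF.bind_apply, tsum_fintype, Finset.sum_congr rfl fun S _ => h1 S,
    Finset.sum_comm, ← Finset.sum_filter_add_sum_filter_not Finset.univ (fun v => v ∈ T)]
  rw [Finset.sum_eq_zero (s := Finset.univ.filter fun v => v ∉ T), add_zero]
  · refine Finset.sum_congr (by ext; simp) fun v hv => ?_
    have hvT : v ∈ T := by simpa using hv
    rw [Finset.sum_eq_single (T.erase v)]
    · rw [if_pos ⟨Finset.notMem_erase v T, Finset.insert_erase hvT⟩]
    · intro S _ hS
      rw [if_neg]
      rintro ⟨hvS, rfl⟩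
      exact hS (Finset.erase_insert hvS).symm
    · simp
  · intro v hv
    refine Finset.sum_eq_zero fun S _ => if_neg ?_
    rintro ⟨-, rfl⟩
    simp at hv

/-! ### Wallenius' recursion and the probability of a single neighbour set -/

theorem wallenius_eq_zero {kB kR : ℕ} {β : ℝ} {n : ℕ} : ∀ {j : ℕ}, n < j →
    wallenius kB kR β n j = 0 := by
  induction n with
  | zero =>
    intro j hj
    obtain ⟨j, rfl⟩ := Nat.exists_eq_succ_of_ne_zero hj.ne'
    rw [wallenius]
  | succ n ih =>
    intro j hj
    obtain ⟨j, rfl⟩ := Nat.exists_eq_succ_of_ne_zero (by omega : j ≠ 0)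
    rw [wallenius, ih (by omega), ih (by omega), zero_mul, zero_mul, add_zero]

theorem wallenius_succ_zero (kB kR : ℕ) (β : ℝ) (n : ℕ) :
    wallenius kB kR β (n + 1) 0 =
      wallenius kB kR β n 0 * (((kR : ℝ) - n) / (β * kB + ((kR : ℝ) - n))) := by
  rw [wallenius]

theorem wallenius_succ_succ (kB kR : ℕ) (β : ℝ) (n j : ℕ) :
    wallenius kB kR β (n + 1) (j + 1) =
      wallenius kB kR β n j *
          (β * ((kB : ℝ) - j) / (β * ((kB : ℝ) - j) + ((kR : ℝ) - ((n : ℝ) - j)))) +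
        wallenius kB kR β n (j + 1) *
          (((kR : ℝ) - ((n : ℝ) - (j + 1))) /
            (β * ((kB : ℝ) - (j + 1)) + ((kR : ℝ) - ((n : ℝ) - (j + 1))))) := by
  rw [wallenius]

/-- Exchanges the number of choices for the last element of a given set for the number of objects
left to draw, which is the factor in Wallenius' recursion. -/
theorem succ_div_choose {K b : ℕ} (h : b + 1 ≤ K) :
    ((b : ℝ) + 1) * ((K.choose b : ℝ))⁻¹ = ((K : ℝ) - b) * ((K.choose (b + 1) : ℝ))⁻¹ := by
  have h1 : (K.choose b : ℝ) ≠ 0 := by exact_mod_cast (Nat.choose_pos (by omega)).ne'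
  have h2 : (K.choose (b + 1) : ℝ) ≠ 0 := by exact_mod_cast (Nat.choose_pos h).ne'
  have h3 : (K.choose (b + 1) : ℝ) * ((b : ℝ) + 1) = K.choose b * ((K : ℝ) - b) := by
    rw [← Nat.cast_sub (by omega : b ≤ K)]
    exact_mod_cast Nat.choose_succ_right_eq K b
  field_simp
  linarith

/-- Probability of each set with `a` base layer and `b` refinement layer symbols. -/
noncomputable def setProb (kB kR : ℕ) (β : ℝ) (a b : ℕ) : ℝ :=
  wallenius kB kR β (a + b) a * ((kB.choose a : ℝ)⁻¹ * (kR.choose b : ℝ)⁻¹)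

theorem setProb_rec_right {kB kR : ℕ} (β : ℝ) {b : ℕ} (hb : b + 1 ≤ kR) :
    setProb kB kR β 0 (b + 1) = ((b : ℝ) + 1) * (setProb kB kR β 0 b *
      (1 * (β * ((kB : ℝ) - 0) + ((kR : ℝ) - b))⁻¹)) := by
  have h := succ_div_choose hb
  simp only [setProb, zero_add, wallenius_succ_zero, div_eq_mul_inv, sub_zero]
  linear_combination (-(wallenius kB kR β b 0 * (β * (kB : ℝ) + ((kR : ℝ) - b))⁻¹ *
    (kB.choose 0 : ℝ)⁻¹)) * h

theorem setProb_rec_left {kB kR : ℕ} (β : ℝ) {a : ℕ} (ha : a + 1 ≤ kB) :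
    setProb kB kR β (a + 1) 0 = ((a : ℝ) + 1) * (setProb kB kR β a 0 *
      (β * (β * ((kB : ℝ) - a) + ((kR : ℝ) - 0))⁻¹)) := by
  have h := succ_div_choose ha
  simp only [setProb, add_zero, wallenius_succ_succ, div_eq_mul_inv, sub_zero, sub_self]
  -- The last draw cannot be from the refinement layer: `a` draws do not yield `a + 1` base layer
  -- objects.
  rw [wallenius_eq_zero (Nat.lt_succ_self a)]
  linear_combination (-(wallenius kB kR β a a * β * (β * ((kB : ℝ) - a) + (kR : ℝ))⁻¹ *
    (kR.choose 0 : ℝ)⁻¹)) * h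

/-- The last draw is one of the `a + 1` base layer or one of the `b + 1` refinement layer elements
of the set; each case is a term of Wallenius' recursion rewritten by `succ_div_choose`. -/
theorem setProb_rec {kB kR : ℕ} (β : ℝ) {a b : ℕ} (ha : a + 1 ≤ kB) (hb : b + 1 ≤ kR) :
    setProb kB kR β (a + 1) (b + 1) =
      ((a : ℝ) + 1) * (setProb kB kR β a (b + 1) *
        (β * (β * ((kB : ℝ) - a) + ((kR : ℝ) - (b + 1)))⁻¹)) +
      ((b : ℝ) + 1) * (setProb kB kR β (a + 1) b *
        (1 * (β * ((kB : ℝ) - (a + 1)) + ((kR : ℝ) - b))⁻¹)) := by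
  have h := succ_div_choose ha
  have h' := succ_div_choose hb
  have e1 : a + 1 + (b + 1) = (a + b + 1) + 1 := by ring
  have e2 : a + (b + 1) = a + b + 1 := by ring
  have e3 : a + 1 + b = a + b + 1 := by ring
  have e4 : ((a + b + 1 : ℕ) : ℝ) - a = b + 1 := by push_cast; ring
  have e5 : ((a + b + 1 : ℕ) : ℝ) - (a + 1) = b := by push_cast; ring
  simp only [setProb, e1, e2, e3]
  rw [wallenius_succ_succ kB kR β (a + b + 1) a]
  simp only [div_eq_mul_inv, e4, e5]
  linear_combination (-(wallenius kB kR β (a + b + 1) a * β *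
      (β * ((kB : ℝ) - a) + ((kR : ℝ) - (b + 1)))⁻¹ * (kR.choose (b + 1) : ℝ)⁻¹)) * h -
    (wallenius kB kR β (a + b + 1) (a + 1) *
      (β * ((kB : ℝ) - (a + 1)) + ((kR : ℝ) - b))⁻¹ * (kB.choose (a + 1) : ℝ)⁻¹) * h'

theorem sum_toLeft_add_sum_toRight {α γ M : Type*} [AddCommMonoid M] (S : Finset (α ⊕ γ))
    (f : α ⊕ γ → M) :
    ∑ v ∈ S, f v = ∑ x ∈ S.toLeft, f (Sum.inl x) + ∑ x ∈ S.toRight, f (Sum.inr x) := by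
  conv_lhs => rw [← Finset.toLeft_disjSum_toRight (u := S)]
  rw [Finset.sum_disjSum]

/-- Both sides satisfy the same recursion in the last selection, whose summands are constant on each
layer. -/
theorem toReal_selectNeighbours {kB kR : ℕ} {β : ℝ≥0} {i : ℕ} (hi : Selectable kB kR β i) :
    ∀ S : Finset (InputSymbol kB kR), (selectNeighbours β i S).toReal =
      if S.card = i then setProb kB kR β S.toLeft.card S.toRight.card else 0 := by
  induction i with
  | zero =>
    intro S
    rw [selectNeighbours, PMF.pure_apply]
    by_cases hS : S = ∅
    · have hc := S.card_toLeft_add_card_toRight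
      have h0 : S.card = 0 := by rw [hS, Finset.card_empty]
      have hL : S.toLeft.card = 0 := by omega
      have hR : S.toRight.card = 0 := by omega
      rw [if_pos hS, if_pos h0, hL, hR]
      simp [setProb, wallenius]
    · rw [if_neg hS, if_neg (by simpa using hS), ENNReal.toReal_zero]
  | succ i ih =>
    have ih := ih ⟨by have := hi.1; omega, fun h => by have := hi.2 h; omega⟩
    -- By the induction hypothesis only sets of size exactly `i` carry mass, and they leave positive
    -- weight by `Selectable`.
    have htot : ∀ T : Finset (InputSymbol kB kR), selectNeighbours β i T ≠ 0 →
        totalRemaining β T ≠ 0 := by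
      intro T hT
      refine totalRemaining_ne_zero hi (of_not_not fun h => hT ?_)
      have := ih T
      rw [if_neg h, ENNReal.toReal_eq_zero_iff] at this
      exact this.resolve_right (PMF.apply_ne_top _ _)
    intro S
    rw [selectNeighbours_succ_apply htot, ENNReal.toReal_sum]
    · simp only [ENNReal.toReal_mul, ENNReal.toReal_inv, ih, toReal_totalRemaining,
        ENNReal.coe_toReal]
      by_cases hS : S.card = i + 1
      · have hc := S.card_toLeft_add_card_toRight
        have hL := card_toLeft_le S
        have hR := card_toRight_le S
        rw [if_pos hS, sum_toLeft_add_sum_toRight]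
        have hl : ∀ x ∈ S.toLeft, (S.erase (Sum.inl x)).card = i ∧
            (S.erase (Sum.inl x)).toLeft.card = S.toLeft.card - 1 ∧
            (S.erase (Sum.inl x)).toRight.card = S.toRight.card := by
          intro x hx
          have hxS := Finset.mem_toLeft.1 hx
          have h1 : (S.erase (Sum.inl x)).toLeft = S.toLeft.erase x := by ext; simp
          have h2 : (S.erase (Sum.inl x)).toRight = S.toRight := by ext; simp
          rw [h1, h2, Finset.card_erase_of_mem hx, Finset.card_erase_of_mem hxS, hS]
          simp
        have hr : ∀ x ∈ S.toRight, (S.erase (Sum.inr x)).card = i ∧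
            (S.erase (Sum.inr x)).toLeft.card = S.toLeft.card ∧
            (S.erase (Sum.inr x)).toRight.card = S.toRight.card - 1 := by
          intro x hx
          have hxS := Finset.mem_toRight.1 hx
          have h1 : (S.erase (Sum.inr x)).toLeft = S.toLeft := by ext; simp
          have h2 : (S.erase (Sum.inr x)).toRight = S.toRight.erase x := by ext; simp
          rw [h1, h2, Finset.card_erase_of_mem hx, Finset.card_erase_of_mem hxS, hS]
          simp
        rw [Finset.sum_congr rfl fun x hx => by
            rw [(hl x hx).1, (hl x hx).2.1, (hl x hx).2.2, if_pos rfl],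
          Finset.sum_congr (s₁ := S.toRight) rfl fun x hx => by
            rw [(hr x hx).1, (hr x hx).2.1, (hr x hx).2.2, if_pos rfl]]
        simp only [weight, Sum.elim_inl, Sum.elim_inr, Finset.sum_const, nsmul_eq_mul]
        generalize S.toLeft.card = a at *
        generalize S.toRight.card = b at *
        -- A set contained in one layer has only one kind of last draw, hence the separate
        -- recursions.
        rcases a with _ | a <;> rcases b with _ | b
        · omega
        · rw [setProb_rec_right _ hR]
          simp
        · rw [setProb_rec_left _ hL]
          simp
        · rw [setProb_rec _ hL hR]
          simp
      · rw [if_neg hS]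
        refine Finset.sum_eq_zero fun v hv => ?_
        rw [if_neg, zero_mul]
        rw [Finset.card_erase_of_mem hv]
        have := Finset.card_pos.2 ⟨v, hv⟩
        omega
    · intro v hv
      refine ne_top_of_le_ne_top ((selectNeighbours β (i + 1)).apply_ne_top S) ?_
      rw [selectNeighbours_succ_apply htot]
      exact Finset.single_le_sum (f := fun v => selectNeighbours β i (S.erase v) *
        ((weight β v : ℝ≥0∞) * (totalRemaining β (S.erase v))⁻¹)) (fun _ _ => zero_le) hv

/-! ### Reduced degree zero -/

/-- Probability that the neighbours of an output symbol of original degree `i` are processed, when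
`lB` and `lR` symbols of the two layers are unprocessed. -/
noncomputable def redundantProb (kB kR : ℕ) (β : ℝ) (lB lR i : ℕ) : ℝ :=
  ∑ j ∈ Finset.HasAntidiagonal.antidiagonal i,
    ((kB - lB).choose j.1 : ℝ) * ((kR - lR).choose j.2 : ℝ) * setProb kB kR β j.1 j.2

theorem redundantProb_eq_zero {kB kR : ℕ} {β : ℝ} {lB lR i : ℕ}
    (h : kB - lB + (kR - lR) < i) : redundantProb kB kR β lB lR i = 0 := by
  refine Finset.sum_eq_zero fun j hj => ?_
  rw [Finset.HasAntidiagonal.mem_antidiagonal] at hj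
  rcases lt_or_ge (kB - lB) j.1 with h1 | h1
  · rw [Nat.choose_eq_zero_of_lt h1]
    simp
  · rw [Nat.choose_eq_zero_of_lt (by omega : kR - lR < j.2)]
    simp

theorem reducedDegreeDist_zero_zero {kB kR : ℕ} (π : PMF ℕ) (β : ℝ) {lB lR : ℕ} (hB : lB ≤ kB)
    (hR : lR ≤ kR) : reducedDegreeDist kB kR π β 0 0 lB lR =
      ∑ i ∈ Finset.Icc 0 (kB - lB + (kR - lR)), (π i).toReal * redundantProb kB kR β lB lR i := by
  rw [reducedDegreeDist, if_pos ⟨⟨Nat.zero_le _, hB⟩, Nat.zero_le _, hR⟩]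
  have e : 0 + 0 + (kB + kR - (lB + lR)) = kB - lB + (kR - lR) := by omega
  rw [e]
  refine Finset.sum_congr rfl fun i _ => ?_
  rw [Finset.filter_true_of_mem (by simp), redundantProb]
  congr 1
  refine Finset.sum_congr rfl fun j hj => ?_
  rw [Finset.HasAntidiagonal.mem_antidiagonal] at hj
  rw [setProb, hj]
  simp only [Nat.choose_zero_right, Nat.cast_one, one_mul, Nat.sub_zero, div_eq_mul_inv]
  ring

/-- A set avoiding `U` is a pair of subsets of the complements of `U` in the two layers, and these
are counted by size. -/
theorem sum_ite_inter_eq_empty {kB kR : ℕ} (U : Finset (InputSymbol kB kR)) (f : ℕ → ℕ → ℝ) :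
    (∑ S : Finset (InputSymbol kB kR), if S ∩ U = ∅ then f S.toLeft.card S.toRight.card else 0) =
      ∑ a ∈ Finset.range (kB - U.toLeft.card + 1), ∑ b ∈ Finset.range (kR - U.toRight.card + 1),
        ((kB - U.toLeft.card).choose a : ℝ) * ((kR - U.toRight.card).choose b : ℝ) * f a b := by
  have h1 : (∑ S : Finset (InputSymbol kB kR),
      if S ∩ U = ∅ then f S.toLeft.card S.toRight.card else 0) =
      ∑ A ∈ (U.toLeft)ᶜ.powerset, ∑ B ∈ (U.toRight)ᶜ.powerset, f A.card B.card := by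
    rw [← Finset.sum_product', ← Finset.sum_filter]
    refine Finset.sum_bij' (fun S _ => (S.toLeft, S.toRight)) (fun P _ => P.1.disjSum P.2)
      ?_ ?_ ?_ ?_ ?_
    · intro S hS
      have hS : S ∩ U = ∅ := by simpa using hS
      rw [← Finset.disjoint_iff_inter_eq_empty, Finset.disjoint_left] at hS
      simp only [Finset.mem_product, Finset.mem_powerset]
      constructor
      · intro x hx
        simpa using hS (Finset.mem_toLeft.1 hx)
      · intro x hx
        simpa using hS (Finset.mem_toRight.1 hx)
    · rintro ⟨A, B⟩ hP
      simp only [Finset.mem_product, Finset.mem_powerset] at hP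
      rw [Finset.mem_filter, ← Finset.disjoint_iff_inter_eq_empty, Finset.disjoint_left]
      refine ⟨Finset.mem_univ _, ?_⟩
      rintro (x | x) hx
      · simpa using hP.1 (Finset.inl_mem_disjSum.1 hx)
      · simpa using hP.2 (Finset.inr_mem_disjSum.1 hx)
    · intro S _
      exact Finset.toLeft_disjSum_toRight
    · intro P _
      simp
    · intro S _
      rfl
  rw [h1]
  have h2 : ∀ A : Finset (Fin kB), ∑ B ∈ (U.toRight)ᶜ.powerset, f A.card B.card =
      ∑ b ∈ Finset.range (kR - U.toRight.card + 1),
        ((kR - U.toRight.card).choose b : ℝ) * f A.card b := by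
    intro A
    rw [Finset.sum_powerset_apply_card (f A.card), Finset.card_compl, Fintype.card_fin]
    simp only [nsmul_eq_mul]
  rw [Finset.sum_congr rfl fun A _ => h2 A, Finset.sum_powerset_apply_card
    (fun a => ∑ b ∈ Finset.range (kR - U.toRight.card + 1),
      ((kR - U.toRight.card).choose b : ℝ) * f a b), Finset.card_compl, Fintype.card_fin]
  simp only [nsmul_eq_mul, Finset.mul_sum, mul_assoc]

/-- Pairs on the antidiagonal outside the rectangle have a vanishing binomial coefficient. -/
theorem sum_range_sum_range_eq_sum_antidiagonal {m n i : ℕ} (g : ℕ → ℕ → ℝ) :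
    (∑ a ∈ Finset.range (m + 1), ∑ b ∈ Finset.range (n + 1),
      (m.choose a : ℝ) * (n.choose b : ℝ) * if a + b = i then g a b else 0) =
      ∑ j ∈ Finset.HasAntidiagonal.antidiagonal i,
        (m.choose j.1 : ℝ) * (n.choose j.2 : ℝ) * g j.1 j.2 := by
  rw [← Finset.sum_product']
  simp only [mul_ite, mul_zero]
  rw [← Finset.sum_filter]
  refine Finset.sum_subset (fun j hj => ?_) fun j hj hj' => ?_
  · rw [Finset.HasAntidiagonal.mem_antidiagonal]
    exact (Finset.mem_filter.1 hj).2
  · rw [Finset.HasAntidiagonal.mem_antidiagonal] at hj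
    simp only [Finset.mem_filter, Finset.mem_product, Finset.mem_range, hj, and_true,
      not_and_or, not_lt] at hj'
    rcases hj' with h | h
    · rw [Nat.choose_eq_zero_of_lt (by omega : m < j.1)]
      simp
    · rw [Nat.choose_eq_zero_of_lt (by omega : n < j.2)]
      simp

open Classical in
theorem toReal_mean_selectNeighbours {kB kR : ℕ} {β : ℝ≥0} {i : ℕ} (hi : Selectable kB kR β i)
    (U : Finset (InputSymbol kB kR)) :
    (mean (selectNeighbours β i) fun S => if S ∩ U = ∅ then 1 else 0).toReal =
      redundantProb kB kR β U.toLeft.card U.toRight.card i := by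
  rw [mean, tsum_fintype, ENNReal.toReal_sum]
  · rw [redundantProb, ← sum_range_sum_range_eq_sum_antidiagonal (setProb kB kR β),
      ← sum_ite_inter_eq_empty U fun a b => if a + b = i then setProb kB kR β a b else 0]
    refine Finset.sum_congr rfl fun S _ => ?_
    rw [ENNReal.toReal_mul, toReal_selectNeighbours hi, Finset.card_toLeft_add_card_toRight]
    split_ifs <;> simp
  · intro S _
    refine ENNReal.mul_ne_top (PMF.apply_ne_top _ _) ?_
    split_ifs <;> simp

/-! ### Parameter zero and degrees exceeding the refinement layer -/

theorem wallenius_zero_weight {kB kR : ℕ} {n : ℕ} : ∀ {j : ℕ}, (j ≠ 0 ∨ kR < n) →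
    wallenius kB kR 0 n j = 0 := by
  induction n with
  | zero =>
    intro j hj
    exact wallenius_eq_zero (by omega)
  | succ n ih =>
    intro j hj
    cases j with
    | zero =>
      rw [wallenius_succ_zero]
      -- On the draw after the refinement layer is exhausted the factor is `0 / 0 = 0`: the formula
      -- loses all its mass, while the encoder keeps the whole layer.
      rcases eq_or_ne kR n with rfl | h
      · simp
      · rw [ih (Or.inr (by omega)), zero_mul]
    | succ j =>
      rw [wallenius_succ_succ, ih (j := j + 1) (Or.inl (by omega))]
      simp

theorem redundantProb_zero_weight {kB kR lB lR i : ℕ} (h : kR < i) :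
    redundantProb kB kR 0 lB lR i = 0 := by
  refine Finset.sum_eq_zero fun j hj => ?_
  rw [Finset.HasAntidiagonal.mem_antidiagonal] at hj
  rw [setProb, hj, wallenius_zero_weight (Or.inr h)]
  simp

/-- Base layer symbols have weight zero, so every selection adds a refinement layer symbol until
none is left. -/
theorem toRight_of_mem_support_selectNeighbours {kB kR : ℕ} (i : ℕ) :
    ∀ S ∈ (selectNeighbours (kB := kB) (kR := kR) 0 i).support,
      S.toRight = Finset.univ ∨ i ≤ S.toRight.card := by
  induction i with
  | zero => intro S _; exact Or.inr (Nat.zero_le _)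
  | succ i ih =>
    intro S hS
    rw [selectNeighbours, PMF.mem_support_bind_iff] at hS
    obtain ⟨T, hT, hS⟩ := hS
    by_cases hR : T.toRight = Finset.univ
    · left
      by_cases ht : totalRemaining 0 T = 0
      · rw [selectOne, dif_pos (by exact ht)] at hS
        simp only [PMF.support_pure, Set.mem_singleton_iff] at hS
        rw [hS, hR]
      · rw [PMF.mem_support_iff, selectOne_apply ht] at hS
        obtain ⟨v, -, hv⟩ := Finset.exists_ne_zero_of_sum_ne_zero hS
        split_ifs at hv with h
        · rw [Finset.eq_univ_iff_forall] at hR ⊢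
          intro x
          rw [Finset.mem_toRight, ← h.2]
          exact Finset.mem_insert_of_mem (Finset.mem_toRight.1 (hR x))
        · exact absurd rfl hv
    · right
      have hcard := (ih T hT).resolve_left hR
      have ht : totalRemaining 0 T ≠ 0 := by
        rw [totalRemaining_eq, ENNReal.coe_zero, zero_mul, zero_add, Nat.cast_ne_zero]
        have := Finset.card_lt_univ_of_notMem
          (not_forall.1 (Finset.eq_univ_iff_forall.not.1 hR)).choose_spec
        rw [Fintype.card_fin] at this
        omega
      rw [PMF.mem_support_iff, selectOne_apply ht] at hS
      obtain ⟨v, -, hv⟩ := Finset.exists_ne_zero_of_sum_ne_zero hS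
      split_ifs at hv with h
      · rcases v with x | x
        · simp [weight] at hv
        · have hx : x ∉ T.toRight := fun hx => h.1 (Finset.mem_toRight.1 hx)
          have : insert x T.toRight ⊆ S.toRight := by
            intro y hy
            rw [Finset.mem_toRight, ← h.2]
            rcases Finset.mem_insert.1 hy with rfl | hy
            · exact Finset.mem_insert_self _ _
            · exact Finset.mem_insert_of_mem (Finset.mem_toRight.1 hy)
          have := Finset.card_le_card this
          rw [Finset.card_insert_of_notMem hx] at this
          omega
      · exact absurd rfl hv

open Classical in
theorem mean_selectNeighbours_zero_weight {kB kR : ℕ} {i : ℕ} (hi : kR < i)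
    {U : Finset (InputSymbol kB kR)} (hU : U.toRight.card ≠ 0) :
    (mean (selectNeighbours 0 i) fun S => if S ∩ U = ∅ then 1 else 0) = 0 := by
  refine (mean_congr fun S hS => if_neg fun hSU => ?_).trans (mean_const _ 0)
  have hR : S.toRight = Finset.univ :=
    (toRight_of_mem_support_selectNeighbours i S hS).resolve_right fun h => by
      have := card_toRight_le S
      omega
  obtain ⟨x, hx⟩ := Finset.card_ne_zero.1 hU
  have hxS : x ∈ S.toRight := hR ▸ Finset.mem_univ x
  have : Sum.inr x ∈ S ∩ U := Finset.mem_inter.2 ⟨Finset.mem_toRight.1 hxS, Finset.mem_toRight.1 hx⟩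
  rw [hSU] at this
  exact absurd this (Finset.notMem_empty _)

open Classical in
/-- Probability that an arriving output symbol is redundant. -/
theorem toReal_mean_encode {kB kR : ℕ} {π : PMF ℕ} (hπ : ∀ i, π i ≠ 0 → i ≤ kB + kR) {β : ℝ≥0}
    {U : Finset (InputSymbol kB kR)} (hU : β = 0 → U.toRight.card ≠ 0) :
    (mean (encode kB kR π β) fun c => if c.2 ∩ U = ∅ then 1 else 0).toReal =
      reducedDegreeDist kB kR π β 0 0 U.toLeft.card U.toRight.card := by
  have hle : ∀ i, (mean (selectNeighbours β i) fun S => if S ∩ U = ∅ then 1 else 0) ≤ 1 :=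
    fun i => mean_le _ fun S => by split_ifs <;> simp
  have h : ∀ i, (π i).toReal *
      (mean (selectNeighbours β i) fun S => if S ∩ U = ∅ then 1 else 0).toReal =
      (π i).toReal * redundantProb kB kR β U.toLeft.card U.toRight.card i := by
    intro i
    by_cases hi : π i = 0
    · simp [hi]
    · congr 1
      -- The only degrees in the support of `π` that are not `Selectable`. Both sides vanish: the
      -- encoder takes the whole refinement layer, which meets `U`, and Wallenius' formula gives
      -- zero.
      by_cases hβ : β = 0 ∧ kR < i
      · obtain ⟨rfl, hi'⟩ := hβ
        rw [mean_selectNeighbours_zero_weight hi' (hU rfl), NNReal.coe_zero,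
          redundantProb_zero_weight hi', ENNReal.toReal_zero]
      · exact toReal_mean_selectNeighbours ⟨hπ i hi, fun h0 => not_lt.1 fun hi' => hβ ⟨h0, hi'⟩⟩ U
  rw [encode, mean_bind]
  simp only [mean_map]
  rw [mean, ENNReal.tsum_toReal_eq fun i =>
    ENNReal.mul_ne_top (π.apply_ne_top i) ((hle i).trans_lt ENNReal.one_lt_top).ne]
  simp only [ENNReal.toReal_mul, h]
  rw [reducedDegreeDist_zero_zero π _ (card_toLeft_le U) (card_toRight_le U), tsum_eq_sum]
  intro i hi
  rw [redundantProb_eq_zero (by simpa using hi), mul_zero]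

/-! ### Expected numbers of receptions -/

theorem state_lB_eq {kB kR : ℕ} (s : Receiver kB kR) :
    s.state.lB = s.unprocessed.toLeft.card := by
  have : (s.unprocessed.filter fun v => v.isLeft = true) =
      s.unprocessed.toLeft.map Function.Embedding.inl := by
    ext v
    cases v <;> simp
  rw [Receiver.state, this, Finset.card_map]

theorem state_lR_eq {kB kR : ℕ} (s : Receiver kB kR) :
    s.state.lR = s.unprocessed.toRight.card := by
  have : (s.unprocessed.filter fun v => v.isRight = true) =
      s.unprocessed.toRight.map Function.Embedding.inr := by
    ext v
    cases v <;> simp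
  rw [Receiver.state, this, Finset.card_map]

open Classical in
/-- Expected number of output symbols received while the receiver satisfies `P`, because decoding
of the first `Δ` symbols failed, for some `1 ≤ Δ ≤ N`. -/
noncomputable def visits {kB kR : ℕ} (π : PMF ℕ) (β : ℝ≥0) (N : ℕ) (P : Receiver kB kR → Prop) :
    ℝ≥0∞ :=
  ∑ m ∈ Finset.Icc 1 N, mean (receiverLaw kB kR π β m) fun s =>
    if s.unprocessed ≠ ∅ ∧ P s then 1 else 0

theorem visits_ne_top {kB kR : ℕ} (π : PMF ℕ) (β : ℝ≥0) (N : ℕ) (P : Receiver kB kR → Prop) :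
    visits π β N P ≠ ∞ :=
  ENNReal.sum_ne_top.2 fun _ _ => ne_top_of_le_ne_top ENNReal.one_ne_top
    (mean_le _ fun s => by split_ifs <;> simp)

theorem exists_of_visits_ne_zero {kB kR : ℕ} {π : PMF ℕ} {β : ℝ≥0} {N : ℕ}
    {P : Receiver kB kR → Prop} (h : visits π β N P ≠ 0) :
    ∃ s, s.unprocessed ≠ ∅ ∧ P s := by
  by_contra hP
  refine h (Finset.sum_eq_zero fun m _ => ?_)
  exact (mean_congr fun s _ => if_neg fun hs => hP ⟨s, hs⟩).trans (mean_const _ 0)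

theorem Icc_one_eq_Ico (N : ℕ) : Finset.Icc 1 N = Finset.Ico 1 (N + 1) := by
  ext
  simp only [Finset.mem_Icc, Finset.mem_Ico]
  omega

theorem expect_countP_drop_one {kB kR : ℕ} {π : PMF ℕ} {β : ℝ≥0} (hkB : 0 < kB) (N : ℕ)
    (P : Receiver kB kR → Prop) [DecidablePred P] :
    expect (transmission kB kR π β (N + 1))
      (fun ω => (ω.1.drop 1).countP fun x => decide (P x.1)) = (visits π β N P).toReal := by
  classical
  rw [expect_eq_toReal_mean]
  simp only [coe_countP fun x : Reception kB kR => P x.1]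
  rw [mean_transmission hkB le_rfl (by omega), visits, Icc_one_eq_Ico]
  congr 1
  refine Finset.sum_congr rfl fun m _ => mean_congr fun s _ => ?_
  by_cases h1 : s.unprocessed = ∅ <;> by_cases h2 : P s <;> simp [h1, h2, mean_const]

theorem expectedReceived₁_eq {kB kR : ℕ} (π : PMF ℕ) (β : ℝ≥0) (hkB : 0 < kB) (N : ℕ)
    (d : DecoderState) : expectedReceived₁ kB kR π β N d =
      (visits π β N fun s : Receiver kB kR => s.state.lB ≠ 0 ∧ s.state = d).toReal := by
  classical
  rw [← expect_countP_drop_one hkB, expectedReceived₁]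

theorem expectedReceived₂_eq {kB kR : ℕ} (π : PMF ℕ) (β : ℝ≥0) (hkB : 0 < kB) (N : ℕ)
    (d : DecoderState) : expectedReceived₂ kB kR π β N d =
      (visits π β N fun s : Receiver kB kR => s.state.lB = 0 ∧ s.state = d).toReal := by
  classical
  rw [← expect_countP_drop_one hkB, expectedReceived₂]

/-- An undecoded base layer means both that transmission is running and that the feedback has not
intervened, so the batch law applies at each time. -/
theorem expectedReceived₁_eq_sum {kB kR : ℕ} (π : PMF ℕ) (β : ℝ≥0) (hkB : 0 < kB) (N : ℕ)
    {d : DecoderState} (hd : d.lB ≠ 0) : expectedReceived₁ kB kR π β N d =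
      ∑ Δ₁ ∈ Finset.Icc 1 N, (terminalDist₁ kB kR π β Δ₁ d).toReal := by
  rw [expectedReceived₁_eq π β hkB, visits,
    ← ENNReal.toReal_sum (f := fun Δ₁ => terminalDist₁ kB kR π β Δ₁ d)
      fun _ _ => PMF.apply_ne_top _ _]
  congr 1
  refine Finset.sum_congr rfl fun m _ => ?_
  rw [terminalDist₁, map_apply_eq_mean]
  refine tsum_congr fun s => ?_
  beta_reduce
  by_cases hs : s.state = d
  · have hB : s.state.lB ≠ 0 := hs ▸ hd
    rw [if_pos ⟨unprocessed_ne_empty_of_lB_ne_zero hB, hB, hs⟩, if_pos hs,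
      receiverLaw_apply_of_lB_ne_zero m s hB]
  · rw [if_neg fun h => hs h.2.2, if_neg hs, mul_zero, mul_zero]

theorem visits_eq_sum_terminalDist₂ {kB kR : ℕ} (π : PMF ℕ) (β : ℝ≥0) (hkB : 0 < kB) (N : ℕ)
    {d : DecoderState} (hd : d.lR ≠ 0) :
    (visits π β N fun s : Receiver kB kR => s.state.lB = 0 ∧ s.state = d) =
      ∑ Δ₁ ∈ Finset.Icc 1 N, ∑ Δ₂ ∈ Finset.Icc Δ₁ N, terminalDist₂ kB kR π β Δ₁ Δ₂ d := by
  classical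
  -- With `Δ₂` outermost, the inner sum over feedback times is the law of the receiver at time `Δ₂`.
  rw [Finset.sum_comm' (t' := Finset.Icc 1 N) (s' := fun Δ₂ => Finset.Icc 1 Δ₂)
    (by intro a b; simp only [Finset.mem_Icc]; omega), visits]
  refine Finset.sum_congr rfl fun m _ => ?_
  simp only [terminalDist₂_eq_tsum]
  rw [← Summable.tsum_finsetSum fun _ _ => ENNReal.summable]
  refine tsum_congr fun s => ?_
  rw [← Finset.sum_mul]
  beta_reduce
  by_cases hs : s.state = d
  · have hU : s.unprocessed ≠ ∅ := unprocessed_ne_empty_of_lR_ne_zero (hs ▸ hd)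
    by_cases hB : s.state.lB = 0
    · rw [if_pos ⟨hU, hB, hs⟩, if_pos hs, receiverLaw_apply_of_lB_eq_zero hkB m s hB hU]
    · rw [if_neg fun h => hB h.2.1, Finset.sum_eq_zero, mul_zero, zero_mul]
      intro Δ _
      by_contra hne
      exact hB (of_finalDist₂_ne_zero hne).2
  · rw [if_neg fun h => hs h.2.2, if_neg hs, mul_zero, mul_zero]

theorem expectedReceived₂_eq_sum {kB kR : ℕ} (π : PMF ℕ) (β : ℝ≥0) (hkB : 0 < kB) (N : ℕ)
    {d : DecoderState} (hd : d.lR ≠ 0) : expectedReceived₂ kB kR π β N d =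
      ∑ Δ₁ ∈ Finset.Icc 1 N, ∑ Δ₂ ∈ Finset.Icc Δ₁ N,
        (terminalDist₂ kB kR π β Δ₁ Δ₂ d).toReal := by
  have htop := visits_ne_top π β N fun s : Receiver kB kR => s.state.lB = 0 ∧ s.state = d
  rw [visits_eq_sum_terminalDist₂ π β hkB N hd, ENNReal.sum_ne_top] at htop
  rw [expectedReceived₂_eq π β hkB, visits_eq_sum_terminalDist₂ π β hkB N hd,
    ENNReal.toReal_sum htop]
  exact Finset.sum_congr rfl fun Δ₁ h => ENNReal.toReal_sum (ENNReal.sum_ne_top.1 (htop Δ₁ h))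

/-! ### Expected redundancy -/

open Classical in
/-- Probability that an output symbol arriving at the receiver `s` is redundant. -/
noncomputable def redundancyAt {kB kR : ℕ} (π : PMF ℕ) (β : ℝ≥0) (s : Receiver kB kR) : ℝ≥0∞ :=
  mean (encode kB kR π (encoderParameter β s)) fun c => if c.2 ∩ s.unprocessed = ∅ then 1 else 0

theorem redundancyAt_le_one {kB kR : ℕ} (π : PMF ℕ) (β : ℝ≥0) (s : Receiver kB kR) :
    redundancyAt π β s ≤ 1 :=
  mean_le _ fun c => by split_ifs <;> simp

theorem toReal_redundancyAt {kB kR : ℕ} {π : PMF ℕ} (hπ : ∀ i, π i ≠ 0 → i ≤ kB + kR) {β : ℝ≥0}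
    (hβ : 0 < β) {s : Receiver kB kR} (hs : s.unprocessed ≠ ∅) :
    (redundancyAt π β s).toReal =
      reducedDegreeDist kB kR π (encoderParameter β s) 0 0 s.state.lB s.state.lR := by
  rw [redundancyAt, state_lB_eq, state_lR_eq]
  refine toReal_mean_encode hπ fun h => ?_
  rw [← state_lR_eq]
  refine lR_ne_zero_of_unprocessed_ne_empty hs ?_
  by_contra hB
  rw [encoderParameter, if_pos hB] at h
  exact hβ.ne' h

theorem redundancyAt_eq {kB kR : ℕ} {π : PMF ℕ} (hπ : ∀ i, π i ≠ 0 → i ≤ kB + kR) {β : ℝ≥0}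
    (hβ : 0 < β) {s : Receiver kB kR} (hs : s.unprocessed ≠ ∅) :
    redundancyAt π β s = ENNReal.ofReal
      (reducedDegreeDist kB kR π (encoderParameter β s) 0 0 s.state.lB s.state.lR) := by
  rw [← toReal_redundancyAt hπ hβ hs,
    ENNReal.ofReal_toReal ((redundancyAt_le_one π β s).trans_lt ENNReal.one_lt_top).ne]

/-- Nothing is processed yet, so only degree zero would be redundant. This removes the first
reception, which `expectedReceived₁` and `expectedReceived₂` do not count. -/
theorem redundancyAt_start {kB kR : ℕ} (hkB : 0 < kB) {π : PMF ℕ}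
    (hπ : ∀ i, π i ≠ 0 → 1 ≤ i ∧ i ≤ kB + kR) {β : ℝ≥0} (hβ : 0 < β) :
    redundancyAt π β (start kB kR) = 0 := by
  have hB := start_state_lB kB kR
  have hR : (start kB kR).state.lR = kR := by
    rw [state_lR_eq]
    have : (start kB kR).unprocessed.toRight = Finset.univ := by ext; simp [start]
    rw [this, Finset.card_univ, Fintype.card_fin]
  have h0 : π 0 = 0 := by
    by_contra h
    exact absurd (hπ 0 h).1 (by omega)
  rw [redundancyAt_eq (fun i hi => (hπ i hi).2) hβ (start_unprocessed_ne_empty kR hkB), hB, hR,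
    reducedDegreeDist_zero_zero π _ le_rfl le_rfl]
  simp [h0]

open Classical in
theorem expectedRedundancy_eq {kB kR : ℕ} (hkB : 0 < kB) {π : PMF ℕ}
    (hπ : ∀ i, π i ≠ 0 → 1 ≤ i ∧ i ≤ kB + kR) {β : ℝ≥0} (hβ : 0 < β) (N : ℕ) :
    expectedRedundancy kB kR π β (N + 1) =
      (∑ m ∈ Finset.Icc 1 N, mean (receiverLaw kB kR π β m) fun s =>
        if s.unprocessed = ∅ then 0 else redundancyAt π β s).toReal := by
  have h := mean_transmission (kR := kR) (π := π) (β := β) hkB (t := 0) (n := N + 1) zero_le_one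
    (Nat.zero_le _) fun x => if x.Redundant then 1 else 0
  have hred : ∀ s : Receiver kB kR, (mean (encode kB kR π (encoderParameter β s)) fun c =>
      if Reception.Redundant (s, c) then 1 else 0) = redundancyAt π β s := fun s =>
    mean_congr fun c _ => by
      by_cases hc : c.2 ∩ s.unprocessed = ∅ <;> simp [Reception.Redundant, hc]
  simp only [List.drop_zero, hred] at h
  rw [expectedRedundancy, expect_eq_toReal_mean]
  simp only [coe_countP]
  rw [h, Finset.sum_eq_sum_Ico_succ_bot (Nat.succ_pos N), receiverLaw_zero, mean_pure,
    if_neg (start_unprocessed_ne_empty kR hkB), Icc_one_eq_Ico]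
  rw [redundancyAt_start hkB hπ hβ, zero_add]

/-! ### Grouping receptions by decoder state -/

theorem tsum_subtype_ite_state {Q : DecoderState → Prop} {kB kR : ℕ} {s : Receiver kB kR}
    (A : Prop) [Decidable A] [∀ d, Decidable (A ∧ s.state = d)] (f : DecoderState → ℝ≥0∞)
    (h : A → Q s.state) :
    (∑' d : {d : DecoderState // Q d}, (if A ∧ s.state = d.1 then 1 else 0) * f d.1) =
      if A then f s.state else 0 := by
  by_cases hA : A
  · rw [tsum_eq_single ⟨s.state, h hA⟩]
    · simp [hA]
    · intro d hd
      rw [if_neg, zero_mul]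
      rintro ⟨-, hd'⟩
      exact hd (Subtype.ext hd'.symm)
  · simp [hA]

/-- Each receiver contributes to the one index equal to its state. Restricting to states with `Q`
loses nothing, since `h` covers the support of the chain. -/
theorem tsum_visits_mul {kB kR : ℕ} {π : PMF ℕ} {β : ℝ≥0} {N : ℕ} {Q : DecoderState → Prop}
    {B : Receiver kB kR → Prop} [DecidablePred fun s : Receiver kB kR => s.unprocessed ≠ ∅ ∧ B s]
    (h : ∀ s ∈ Set.range (finalReceiver (kB := kB) (kR := kR)), s.unprocessed ≠ ∅ → B s →
      Q s.state) (f : DecoderState → ℝ≥0∞) :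
    (∑' d : {d : DecoderState // Q d}, visits π β N (fun s => B s ∧ s.state = d.1) * f d.1) =
      ∑ m ∈ Finset.Icc 1 N, mean (receiverLaw kB kR π β m) fun s =>
        if s.unprocessed ≠ ∅ ∧ B s then f s.state else 0 := by
  classical
  simp only [visits, Finset.sum_mul, ← mean_mul_const]
  rw [Summable.tsum_finsetSum fun _ _ => ENNReal.summable]
  refine Finset.sum_congr rfl fun m _ => ?_
  rw [← mean_tsum]
  refine mean_congr fun s hs => ?_
  simp only [← and_assoc]
  exact tsum_subtype_ite_state _ f fun hA => h s (receiverLaw_support m hs) hA.1 hA.2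

/-- The sign of `x` matters only if some receiver realises `P`; otherwise both sides are zero. It
will be a reduced degree probability, known to be nonnegative only at states of receivers. -/
theorem toReal_visits_mul_ofReal {kB kR : ℕ} {π : PMF ℕ} {β : ℝ≥0} {N : ℕ}
    {P : Receiver kB kR → Prop} {x : ℝ} (h : ∀ s : Receiver kB kR, s.unprocessed ≠ ∅ → P s → 0 ≤ x) :
    (visits π β N P * ENNReal.ofReal x).toReal = (visits π β N P).toReal * x := by
  rw [ENNReal.toReal_mul]
  by_cases h0 : visits π β N P = 0
  · rw [h0, ENNReal.toReal_zero, zero_mul, zero_mul]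
  · obtain ⟨s, hU, hs⟩ := exists_of_visits_ne_zero h0
    rw [ENNReal.toReal_ofReal (h s hU hs)]

end URTLT

/-! ### The redundancy formula -/

theorem theorem3 (kB kR : ℕ) (hkB : 0 < kB) (π : PMF ℕ)
    (hπ : ∀ i, π i ≠ 0 → 1 ≤ i ∧ i ≤ kB + kR) (β : ℝ≥0) (hβ : 0 < β) (Δmax : ℕ) :
    (Summable (fun d : {d : URTLT.DecoderState // d.IsTerminal ∧ d.lB ≠ 0} =>
        URTLT.expectedReceived₁ kB kR π β Δmax d.1 *
          URTLT.reducedDegreeDist kB kR π β 0 0 d.1.lB d.1.lR) ∧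
      Summable (fun d : {d : URTLT.DecoderState // d.IsTerminal ∧ d.lR ≠ 0} =>
        URTLT.expectedReceived₂ kB kR π β Δmax d.1 *
          URTLT.reducedDegreeDist kB kR π 0 0 0 d.1.lB d.1.lR) ∧
      URTLT.expectedRedundancy kB kR π β (Δmax + 1) =
        (∑' d : {d : URTLT.DecoderState // d.IsTerminal ∧ d.lB ≠ 0},
          URTLT.expectedReceived₁ kB kR π β Δmax d.1 *
            URTLT.reducedDegreeDist kB kR π β 0 0 d.1.lB d.1.lR) +
        ∑' d : {d : URTLT.DecoderState // d.IsTerminal ∧ d.lR ≠ 0},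
          URTLT.expectedReceived₂ kB kR π β Δmax d.1 *
            URTLT.reducedDegreeDist kB kR π 0 0 0 d.1.lB d.1.lR) ∧
    (∀ d : URTLT.DecoderState, d.IsTerminal → d.lB ≠ 0 →
      URTLT.expectedReceived₁ kB kR π β Δmax d =
        ∑ Δ₁ ∈ Finset.Icc 1 Δmax, (URTLT.terminalDist₁ kB kR π β Δ₁ d).toReal) ∧
    (∀ d : URTLT.DecoderState, d.IsTerminal → d.lR ≠ 0 →
      URTLT.expectedReceived₂ kB kR π β Δmax d =
        ∑ Δ₁ ∈ Finset.Icc 1 Δmax, ∑ Δ₂ ∈ Finset.Icc Δ₁ Δmax,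
          (URTLT.terminalDist₂ kB kR π β Δ₁ Δ₂ d).toReal) := by
  classical
  refine ⟨?_, fun d _ hd => URTLT.expectedReceived₁_eq_sum π β hkB Δmax hd,
    fun d _ hd => URTLT.expectedReceived₂_eq_sum π β hkB Δmax hd⟩
  have hπ' : ∀ i, π i ≠ 0 → i ≤ kB + kR := fun i hi => (hπ i hi).2
  have hpar₁ : ∀ s : URTLT.Receiver kB kR, s.state.lB ≠ 0 →
      ((URTLT.encoderParameter β s : ℝ≥0) : ℝ) = β := fun s hB => by
    rw [URTLT.encoderParameter, if_pos hB]
  have hpar₂ : ∀ s : URTLT.Receiver kB kR, s.state.lB = 0 →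
      ((URTLT.encoderParameter β s : ℝ≥0) : ℝ) = 0 := fun s hB => by
    rw [URTLT.encoderParameter, if_neg (not_not.2 hB), NNReal.coe_zero]
  have hterm₁ : ∀ d : URTLT.DecoderState, URTLT.expectedReceived₁ kB kR π β Δmax d *
      URTLT.reducedDegreeDist kB kR π β 0 0 d.lB d.lR =
      (URTLT.visits π β Δmax (fun s : URTLT.Receiver kB kR => s.state.lB ≠ 0 ∧ s.state = d) *
        ENNReal.ofReal (URTLT.reducedDegreeDist kB kR π β 0 0 d.lB d.lR)).toReal := by
    intro d
    rw [URTLT.expectedReceived₁_eq π β hkB, URTLT.toReal_visits_mul_ofReal]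
    rintro s hU ⟨hB, rfl⟩
    have h := URTLT.toReal_redundancyAt hπ' hβ hU
    rw [hpar₁ s hB] at h
    exact h ▸ ENNReal.toReal_nonneg
  have hterm₂ : ∀ d : URTLT.DecoderState, URTLT.expectedReceived₂ kB kR π β Δmax d *
      URTLT.reducedDegreeDist kB kR π 0 0 0 d.lB d.lR =
      (URTLT.visits π β Δmax (fun s : URTLT.Receiver kB kR => s.state.lB = 0 ∧ s.state = d) *
        ENNReal.ofReal (URTLT.reducedDegreeDist kB kR π 0 0 0 d.lB d.lR)).toReal := by
    intro d
    rw [URTLT.expectedReceived₂_eq π β hkB, URTLT.toReal_visits_mul_ofReal]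
    rintro s hU ⟨hB, rfl⟩
    have h := URTLT.toReal_redundancyAt hπ' hβ hU
    rw [hpar₂ s hB] at h
    exact h ▸ ENNReal.toReal_nonneg
  have hsum₁ := URTLT.tsum_visits_mul (kB := kB) (kR := kR) (π := π) (β := β) (N := Δmax)
    (Q := fun d => d.IsTerminal ∧ d.lB ≠ 0) (B := fun s => s.state.lB ≠ 0)
    (by rintro _ ⟨M, rfl⟩ _ hB; exact ⟨URTLT.isTerminal_finalReceiver M, hB⟩)
    fun d => ENNReal.ofReal (URTLT.reducedDegreeDist kB kR π β 0 0 d.lB d.lR)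
  have hsum₂ := URTLT.tsum_visits_mul (kB := kB) (kR := kR) (π := π) (β := β) (N := Δmax)
    (Q := fun d => d.IsTerminal ∧ d.lR ≠ 0) (B := fun s => s.state.lB = 0)
    (by
      rintro _ ⟨M, rfl⟩ hU hB
      exact ⟨URTLT.isTerminal_finalReceiver M, URTLT.lR_ne_zero_of_unprocessed_ne_empty hU hB⟩)
    fun d => ENNReal.ofReal (URTLT.reducedDegreeDist kB kR π 0 0 0 d.lB d.lR)
  have hsplit : (∑ m ∈ Finset.Icc 1 Δmax, URTLT.mean (URTLT.receiverLaw kB kR π β m) fun s =>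
      if s.unprocessed = ∅ then 0 else URTLT.redundancyAt π β s) =
      (∑' d : {d : URTLT.DecoderState // d.IsTerminal ∧ d.lB ≠ 0}, URTLT.visits π β Δmax
        (fun s : URTLT.Receiver kB kR => s.state.lB ≠ 0 ∧ s.state = d.1) *
          ENNReal.ofReal (URTLT.reducedDegreeDist kB kR π β 0 0 d.1.lB d.1.lR)) +
      ∑' d : {d : URTLT.DecoderState // d.IsTerminal ∧ d.lR ≠ 0}, URTLT.visits π β Δmax
        (fun s : URTLT.Receiver kB kR => s.state.lB = 0 ∧ s.state = d.1) *
          ENNReal.ofReal (URTLT.reducedDegreeDist kB kR π 0 0 0 d.1.lB d.1.lR) := by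
    rw [hsum₁, hsum₂, ← Finset.sum_add_distrib]
    refine Finset.sum_congr rfl fun m _ => ?_
    rw [← URTLT.mean_add]
    refine URTLT.mean_congr fun s _ => ?_
    by_cases hU : s.unprocessed = ∅
    · simp [hU]
    · rw [if_neg hU, URTLT.redundancyAt_eq hπ' hβ hU]
      by_cases hB : s.state.lB = 0
      · rw [hpar₂ s hB, if_neg fun h => h.2 hB, if_pos ⟨hU, hB⟩, zero_add]
      · rw [hpar₁ s hB, if_pos ⟨hU, hB⟩, if_neg fun h => hB h.2, add_zero]
  -- The total is at most `Δmax`; through `hsplit` its finiteness yields the summability of both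
  -- series.
  have htop : (∑ m ∈ Finset.Icc 1 Δmax, URTLT.mean (URTLT.receiverLaw kB kR π β m) fun s =>
      if s.unprocessed = ∅ then 0 else URTLT.redundancyAt π β s) ≠ ∞ :=
    ENNReal.sum_ne_top.2 fun m _ => ne_top_of_le_ne_top ENNReal.one_ne_top
      (URTLT.mean_le _ fun s => by
        split_ifs
        · exact zero_le
        · exact URTLT.redundancyAt_le_one π β s)
  rw [hsplit, ENNReal.add_ne_top] at htop
  simp only [hterm₁, hterm₂]
  refine ⟨ENNReal.summable_toReal htop.1, ENNReal.summable_toReal htop.2, ?_⟩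
  rw [URTLT.expectedRedundancy_eq hkB hπ hβ, hsplit, ENNReal.toReal_add htop.1 htop.2,
    ENNReal.tsum_toReal_eq (ENNReal.ne_top_of_tsum_ne_top htop.1),
    ENNReal.tsum_toReal_eq (ENNReal.ne_top_of_tsum_ne_top htop.2)]
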